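/- Let $Q$ be a finite additive abelian group, $\Bbbk$ a field, and $\mathfrak g=\bigoplus_{\alpha\in Q}\mathfrak g_\alpha$ a $Q$-graded Lie algebra over $\Bbbk$ (so $[\mathfrak g_\alpha,\mathfrak g_\beta]\subseteq\mathfrak g_{\alpha+\beta}$ for all $\alpha,\beta\in Q$), of arbitrary dimension, that is graded simple: $\mathfrak g$ is not commutative, and its only graded ideals are $0$ and $\mathfrak g$. Suppose that one of the following holds: (i) $\Bbbk$ contains a primitive root of unity of order $|Q|$; (ii) $\Bbbk$ is algebraically closed and $\dim_\Bbbk\mathfrak g<|\Bbbk|$ (as cardinals). Then there exist a subgroup $P\subseteq Q$ and a simple Lie algebra $\mathfrak a$ over $\Bbbk$ with a $Q/P$-grading $\mathfrak a=\bigoplus_{\bar\alpha\in Q/P}\mathfrak a_{\bar\alpha}$ such that $\mathfrak g$ is isomorphic, as a $Q$-graded Lie algebra, to the loop algebra $$\mathfrak g(Q,P,\mathfrak a)=\bigoplus_{\alpha\in Q}\mathfrak a_{\bar\alpha}\otimes t^\alpha\subseteq\mathfrak a\otimes\Bbbk Q,\qquad [x\otimes t^\alpha,y\otimes t^\beta]=[x,y]\otimes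 t^{\alpha+\beta},$$ where $\bar\alpha=\alpha+P$ and $\{t^\alpha:\alpha\in Q\}$ is the standard basis of the group algebra $\Bbbk Q$. That is, there is a Lie algebra isomorphism $\mathfrak g\to\mathfrak g(Q,P,\mathfrak a)$ that maps $\mathfrak g_\alpha$ onto $\mathfrak a_{\bar\alpha}\otimes t^\alpha$ for every $\alpha\in Q$. -/

import Mathlib

open scoped TensorProduct

universe u v w

/-- A Lie algebra `L` with a grading `𝒜` is *graded simple* if it is not commutative and its only
graded (homogeneous) ideals are `0` and `L`. -/
class IsGradedSimpleLie {ι k L : Type*} [DecidableEq ι] [AddCommMonoid ι] [CommRing k]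
    [LieRing L] [LieAlgebra k L] (𝒜 : ι → Submodule k L) [GradedLieAlgebra 𝒜] : Prop where
  non_abelian : ¬ IsLieAbelian L
  eq_bot_or_eq_top : ∀ I : LieIdeal k L, I.toSubmodule.IsHomogeneous 𝒜 → I = ⊥ ∨ I = ⊤

/-- An isomorphism of graded Lie algebras with the same grading group, preserving degrees:
a Lie algebra isomorphism that maps the component of each degree onto the component of the
same degree. -/
structure GradedLieIso {ι k L L' : Type*} [CommRing k] [LieRing L] [LieAlgebra k L]
    [LieRing L'] [LieAlgebra k L'] (𝒜 : ι → Submodule k L) (ℬ : ι → Submodule k L')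
    extends L ≃ₗ⁅k⁆ L' where
  map_component : ∀ i, (𝒜 i).map (toLieEquiv.toLinearEquiv : L →ₗ[k] L') = ℬ i

namespace GradedLoop

variable {Q k 𝔞 : Type*} [AddCommGroup Q] [CommRing k] [LieRing 𝔞] [LieAlgebra k 𝔞]
  (P : AddSubgroup Q) (ℬ : Q ⧸ P → Submodule k 𝔞)

/-- The subspace `𝔞_{α + P} ⊗ t ^ α` of `𝔞 ⊗ k[Q]`. Mathlib writes the group algebra factor
on the left, and the basis vector `t ^ α` is `AddMonoidAlgebra.single α 1`. -/
noncomputable def component (α : Q) : Submodule k (AddMonoidAlgebra k Q ⊗[k] 𝔞) :=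
  (ℬ (α : Q ⧸ P)).map
    (TensorProduct.mk k (AddMonoidAlgebra k Q) 𝔞 (AddMonoidAlgebra.single α 1))

theorem lie_mem_component [SetLike.GradedBracket ℬ] {α β : Q}
    {x y : AddMonoidAlgebra k Q ⊗[k] 𝔞} (hx : x ∈ component P ℬ α) (hy : y ∈ component P ℬ β) :
    ⁅x, y⁆ ∈ component P ℬ (α + β) := by
  obtain ⟨x, hx, rfl⟩ := hx
  obtain ⟨y, hy, rfl⟩ := hy
  refine ⟨⁅x, y⁆, SetLike.GradedBracket.bracket_mem hx hy, ?_⟩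
  simp [AddMonoidAlgebra.single_mul_single]

/-- The loop algebra `𝔤(Q, P, 𝔞) = ⨁ α, 𝔞_{α + P} ⊗ t ^ α` of a Lie algebra `𝔞` with a
`Q / P`-grading `ℬ`, as a Lie subalgebra of `𝔞 ⊗ k[Q]`, whose bracket is
`⁅x ⊗ t ^ α, y ⊗ t ^ β⁆ = ⁅x, y⁆ ⊗ t ^ (α + β)`. -/
noncomputable def algebra [SetLike.GradedBracket ℬ] :
    LieSubalgebra k (AddMonoidAlgebra k Q ⊗[k] 𝔞) where
  toSubmodule := ⨆ α, component P ℬ α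
  lie_mem' := by
    intro x y hx hy
    change x ∈ ⨆ α, component P ℬ α at hx
    change y ∈ ⨆ α, component P ℬ α at hy
    change ⁅x, y⁆ ∈ ⨆ α, component P ℬ α
    induction hx using Submodule.iSup_induction' with
    | zero =>
      have h : ⁅(0 : AddMonoidAlgebra k Q ⊗[k] 𝔞), y⁆ = 0 := zero_lie y
      exact h.symm ▸ zero_mem (⨆ α, component P ℬ α)
    | add a b _ _ ha hb =>
      exact (add_lie a b y : ⁅a + b, y⁆ = ⁅a, y⁆ + ⁅b, y⁆) ▸ add_mem ha hb
    | mem α a ha =>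
      induction hy using Submodule.iSup_induction' with
      | zero =>
        have h : ⁅a, (0 : AddMonoidAlgebra k Q ⊗[k] 𝔞)⁆ = 0 := lie_zero a
        exact h.symm ▸ zero_mem (⨆ α, component P ℬ α)
      | add c d _ _ hc hd =>
        exact (lie_add a c d : ⁅a, c + d⁆ = ⁅a, c⁆ + ⁅a, d⁆) ▸ add_mem hc hd
      | mem β b hb => exact Submodule.mem_iSup_of_mem _ (lie_mem_component P ℬ ha hb)

/-- The `Q`-grading of the loop algebra: the component of degree `α` is `𝔞_{α + P} ⊗ t ^ α`. -/
noncomputable def grading [SetLike.GradedBracket ℬ] (α : Q) : Submodule k (algebra P ℬ) :=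
  (component P ℬ α).comap (algebra P ℬ).toSubmodule.subtype

theorem component_le [SetLike.GradedBracket ℬ] (α : Q) :
    component P ℬ α ≤ (algebra P ℬ).toSubmodule :=
  le_iSup (component P ℬ) α

theorem iSupIndep_component : iSupIndep (component P ℬ) := by
  have h : iSupIndep fun α : Q ↦ LinearMap.range (Finsupp.lsingle α : 𝔞 →ₗ[k] Q →₀ 𝔞) := by
    classical
    rw [iSupIndep_def]
    intro α
    rw [Submodule.disjoint_def]
    rintro _ ⟨x, rfl⟩ hx
    have : (⨆ j, ⨆ (_ : j ≠ α), LinearMap.range (Finsupp.lsingle j : 𝔞 →ₗ[k] Q →₀ 𝔞)) ≤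
        LinearMap.ker (Finsupp.lapply α : (Q →₀ 𝔞) →ₗ[k] 𝔞) := by
      refine iSup₂_le fun j hj ↦ ?_
      rintro _ ⟨y, rfl⟩
      simp [hj]
    have hx := this hx
    simp at hx
    simp [hx]
  have h2 := h.map_orderIso
    (Submodule.orderIsoMapComap (LieAlgebra.LoopAlgebra.toFinsupp k Q 𝔞).symm)
  refine h2.mono fun α ↦ ?_
  rintro _ ⟨x, -, rfl⟩
  exact ⟨Finsupp.single α x, ⟨x, rfl⟩, by simp⟩

theorem isInternal_grading [DecidableEq Q] [SetLike.GradedBracket ℬ] :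
    DirectSum.IsInternal (grading P ℬ) := by
  have hmap : ∀ α, (grading P ℬ α).map (algebra P ℬ).toSubmodule.subtype = component P ℬ α :=
    fun α ↦ by
      rw [grading, Submodule.map_comap_subtype]
      exact inf_eq_right.2 (component_le P ℬ α)
  rw [DirectSum.isInternal_submodule_iff_iSupIndep_and_iSup_eq_top]
  constructor
  · rw [iSupIndep_def]
    intro α
    have h := iSupIndep_component P ℬ α
    rw [Submodule.disjoint_def] at h ⊢
    intro x hx hx'
    refine Subtype.ext (h x hx ?_)
    have h' := Submodule.mem_map_of_mem (f := (algebra P ℬ).toSubmodule.subtype) hx'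
    simp only [Submodule.map_iSup, hmap] at h'
    exact h'
  · apply Submodule.map_injective_of_injective (algebra P ℬ).toSubmodule.injective_subtype
    rw [Submodule.map_iSup, Submodule.map_subtype_top]
    simp only [hmap]
    rfl

/-- The loop algebra is a `Q`-graded Lie algebra. -/
noncomputable instance [DecidableEq Q] [SetLike.GradedBracket ℬ] :
    GradedLieAlgebra (grading P ℬ) where
  bracket_mem _ _ _ _ hx hy := lie_mem_component P ℬ hx hy
  __ := (isInternal_grading P ℬ).chooseDecomposition

end GradedLoop

/-! In a loop algebra, `t ^ α ↦ 1` gives a surjection onto `𝔞`, so `𝔞` must be a quotient of `𝔤` by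
a maximal ideal `I`. Conversely, for any ideal `I ≠ 𝔤` the map `x ↦ ∑ t ^ α ⊗ (x_α mod I)` is a Lie
homomorphism, injective because the elements with all components in `I` form a proper graded ideal.
Its image is the loop algebra of `𝔤 ⧸ I` once `I` is `Q ⧸ P`-graded and components of degrees
congruent modulo `P` have the same image modulo `I`; for maximal `I` the quotient is simple because
`[𝔤, 𝔤] = 𝔤`. It remains to find `P` and `I` (`exists_gradedLieIso_of_isCoatom`).

(i) Any maximal ideal `I` works. The characters of `Q` act on `𝔤` by automorphisms; `H` is the
stabilizer of `I` and `P` the annihilator of `H`. Averaging over `H` projects onto degrees in a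
coset of `P`, so `I` is `Q ⧸ P`-graded. Maximal ideals are prime, so `I` is comaximal with the
intersection of its translates under characters outside `H`. Averaging over all characters then
moves an element from one degree to a congruent one, modulo `I`.

(ii) The centroid is used. Its degree `0` part is a field embedding into `𝔤`, hence equals `k` by
the bound on the dimension. The centroid is then a group algebra with basis `t γ`, `γ ∈ P`, where
`P` is its support. The ideal `I` identifies `x` with `t γ x`; it is maximal because an element of
minimal support modulo `I` would otherwise produce an element of the centroid of degree outside `P`.
-/

/-! ### Homogeneous components and ideals of a graded simple Lie algebra. -/

section GradedProjection

variable {Q k 𝔤 : Type*} [AddCommGroup Q] [CommRing k] [LieRing 𝔤] [LieAlgebra k 𝔤]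
  [DecidableEq Q] (𝒜 : Q → Submodule k 𝔤) [GradedLieAlgebra 𝒜]

/-- The projection of a graded Lie algebra onto its component of degree `α`. -/
noncomputable def gproj (α : Q) : 𝔤 →ₗ[k] 𝔤 :=
  (𝒜 α).subtype ∘ₗ DirectSum.component k Q (fun i ↦ 𝒜 i) α ∘ₗ
    (DirectSum.decomposeLinearEquiv 𝒜 : 𝔤 →ₗ[k] DirectSum Q fun i ↦ 𝒜 i)

theorem gproj_apply (α : Q) (x : 𝔤) : gproj 𝒜 α x = DirectSum.decompose 𝒜 x α := rfl

theorem gproj_mem (α : Q) (x : 𝔤) : gproj 𝒜 α x ∈ 𝒜 α := by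
  rw [gproj_apply]; exact Subtype.property _

variable {𝒜} in
theorem gproj_of_mem {α : Q} {x : 𝔤} (hx : x ∈ 𝒜 α) : gproj 𝒜 α x = x :=
  DirectSum.decompose_of_mem_same 𝒜 hx

variable {𝒜} in
theorem gproj_of_mem_ne {α β : Q} {x : 𝔤} (hx : x ∈ 𝒜 α) (h : α ≠ β) : gproj 𝒜 β x = 0 :=
  DirectSum.decompose_of_mem_ne 𝒜 hx h

theorem sum_gproj [Fintype Q] (x : 𝔤) : ∑ α, gproj 𝒜 α x = x := by
  conv_rhs => rw [← (DirectSum.decompose 𝒜).symm_apply_apply x]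
  rw [← DirectSum.decomposeLinearEquiv_symm_apply,
    ← DirectSum.sum_univ_of (DirectSum.decompose 𝒜 x), map_sum]
  refine Finset.sum_congr rfl fun α _ ↦ ?_
  rw [DirectSum.decomposeLinearEquiv_symm_apply, DirectSum.decompose_symm_of]
  simp [gproj_apply]

theorem eq_zero_of_gproj [Fintype Q] {x : 𝔤} (h : ∀ α, gproj 𝒜 α x = 0) : x = 0 := by
  rw [← sum_gproj 𝒜 x]; simp [h]

variable {𝒜} in
theorem gproj_add_lie {β : Q} {y : 𝔤} (hy : y ∈ 𝒜 β) (α : Q) (x : 𝔤) :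
    gproj 𝒜 (β + α) ⁅y, x⁆ = ⁅y, gproj 𝒜 α x⁆ := by
  induction x using DirectSum.Decomposition.inductionOn 𝒜 with
  | zero => simp
  | @homogeneous i m =>
    have hb : ⁅y, (m : 𝔤)⁆ ∈ 𝒜 (β + i) := SetLike.GradedBracket.bracket_mem hy m.2
    by_cases h : i = α
    · subst h; rw [gproj_of_mem hb, gproj_of_mem m.2]
    · rw [gproj_of_mem_ne hb (by simpa using h), gproj_of_mem_ne m.2 h, lie_zero]
  | add a b ha hb => simp only [lie_add, map_add, ha, hb]

variable {𝒜} in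
theorem gproj_lie {β : Q} {y : 𝔤} (hy : y ∈ 𝒜 β) (α : Q) (x : 𝔤) :
    gproj 𝒜 α ⁅y, x⁆ = ⁅y, gproj 𝒜 (α - β) x⁆ := by
  rw [← gproj_add_lie hy, add_sub_cancel]

/-- A submodule stable under brackets with homogeneous elements is stable under all brackets. -/
theorem lie_mem_of_homogeneous [Fintype Q] {M : Type*} [AddCommGroup M] [Module k M]
    [LieRingModule 𝔤 M] (S : Submodule k M)
    (h : ∀ β, ∀ y ∈ 𝒜 β, ∀ x ∈ S, ⁅y, x⁆ ∈ S) (y : 𝔤) {x : M} (hx : x ∈ S) : ⁅y, x⁆ ∈ S := by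
  rw [← sum_gproj 𝒜 y, sum_lie]
  exact Submodule.sum_mem _ fun β _ ↦ h β _ (gproj_mem 𝒜 β y) x hx

/-- The elements all of whose homogeneous components lie in an ideal. -/
noncomputable def homogeneousCore [Fintype Q] (I : LieIdeal k 𝔤) : LieIdeal k 𝔤 where
  toSubmodule := ⨅ α, I.toSubmodule.comap (gproj 𝒜 α)
  lie_mem {y x} hx := by
    refine lie_mem_of_homogeneous 𝒜 (⨅ α, I.toSubmodule.comap (gproj 𝒜 α)) ?_ y hx
    intro β y hy x hx
    simp only [Submodule.mem_iInf, Submodule.mem_comap] at hx ⊢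
    intro α
    rw [gproj_lie hy]
    exact I.lie_mem (hx _)

theorem mem_homogeneousCore [Fintype Q] {I : LieIdeal k 𝔤} {x : 𝔤} :
    x ∈ homogeneousCore 𝒜 I ↔ ∀ α, gproj 𝒜 α x ∈ I := by
  change x ∈ (⨅ α, I.toSubmodule.comap (gproj 𝒜 α)) ↔ _
  simp [Submodule.mem_iInf]

variable [IsGradedSimpleLie 𝒜]

theorem ideal_eq_bot_or_eq_top_of_gproj_mem (I : LieIdeal k 𝔤)
    (h : ∀ α, ∀ x ∈ I, gproj 𝒜 α x ∈ I) : I = ⊥ ∨ I = ⊤ :=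
  IsGradedSimpleLie.eq_bot_or_eq_top (𝒜 := 𝒜) I fun i _ hx ↦ h i _ hx

theorem homogeneousCore_eq_bot_or_eq_top [Fintype Q] (I : LieIdeal k 𝔤) :
    homogeneousCore 𝒜 I = ⊥ ∨ homogeneousCore 𝒜 I = ⊤ := by
  refine ideal_eq_bot_or_eq_top_of_gproj_mem 𝒜 _ fun α x hx ↦ ?_
  rw [mem_homogeneousCore] at hx ⊢
  intro β
  by_cases h : α = β
  · subst h; rw [gproj_of_mem (gproj_mem 𝒜 α x)]; exact hx α
  · rw [gproj_of_mem_ne (gproj_mem 𝒜 α x) h]; exact zero_mem I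

theorem eq_zero_of_forall_gproj_mem [Fintype Q] {I : LieIdeal k 𝔤} (hI : I ≠ ⊤) {x : 𝔤}
    (hx : ∀ α, gproj 𝒜 α x ∈ I) : x = 0 := by
  rcases homogeneousCore_eq_bot_or_eq_top 𝒜 I with h | h
  · rwa [← mem_homogeneousCore, h, LieSubmodule.mem_bot] at hx
  · refine absurd (eq_top_iff.2 fun y _ ↦ ?_) hI
    rw [← sum_gproj 𝒜 y]
    exact sum_mem fun α _ ↦ (mem_homogeneousCore 𝒜).1 (h ▸ LieSubmodule.mem_top y) α

variable {𝒜} in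
theorem eq_top_of_homogeneous_mem [Fintype Q] {I : LieIdeal k 𝔤} {α : Q} {x : 𝔤} (hx : x ∈ 𝒜 α)
    (hx0 : x ≠ 0) (hxI : x ∈ I) : I = ⊤ := by
  by_contra hI
  refine hx0 (eq_zero_of_forall_gproj_mem 𝒜 hI fun β ↦ ?_)
  by_cases h : α = β
  · subst h; rwa [gproj_of_mem hx]
  · rw [gproj_of_mem_ne hx h]; exact zero_mem I

theorem exists_homogeneous_ne_zero [Fintype Q] : ∃ α, ∃ x ∈ 𝒜 α, x ≠ 0 := by
  by_contra! h
  refine IsGradedSimpleLie.non_abelian 𝒜 ⟨fun x y ↦ ?_⟩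
  have (x : 𝔤) : x = 0 := eq_zero_of_gproj 𝒜 fun α ↦ h α _ (gproj_mem 𝒜 α x)
  exact this _

end GradedProjection

/-- Some bracket of homogeneous elements is nonzero; it is homogeneous, so it generates `𝔤` as an
ideal. -/
theorem lie_top_top_eq_top {Q k 𝔤 : Type*} [AddCommGroup Q] [CommRing k] [LieRing 𝔤]
    [LieAlgebra k 𝔤] [DecidableEq Q] [Fintype Q] (𝒜 : Q → Submodule k 𝔤) [GradedLieAlgebra 𝒜]
    [IsGradedSimpleLie 𝒜] : (⁅(⊤ : LieIdeal k 𝔤), (⊤ : LieIdeal k 𝔤)⁆) = ⊤ := by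
  obtain ⟨x, y, hxy⟩ : ∃ x y : 𝔤, ⁅x, y⁆ ≠ 0 := by
    by_contra! h
    exact IsGradedSimpleLie.non_abelian 𝒜 ⟨h⟩
  obtain ⟨α, hα⟩ : ∃ α, ⁅gproj 𝒜 α x, y⁆ ≠ 0 := by
    by_contra! h
    rw [← sum_gproj 𝒜 x, sum_lie] at hxy
    simp [h] at hxy
  obtain ⟨β, hβ⟩ : ∃ β, ⁅gproj 𝒜 α x, gproj 𝒜 β y⁆ ≠ 0 := by
    by_contra! h
    rw [← sum_gproj 𝒜 y, lie_sum] at hα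
    simp [h] at hα
  exact eq_top_of_homogeneous_mem
    (SetLike.GradedBracket.bracket_mem (gproj_mem 𝒜 α x) (gproj_mem 𝒜 β y)) hβ
    (LieSubmodule.lie_mem_lie (LieSubmodule.mem_top _) (LieSubmodule.mem_top _))

/-! ### Quotients by maximal ideals. -/

section Quotient

variable {k 𝔤 : Type*} [CommRing k] [LieRing 𝔤] [LieAlgebra k 𝔤]

/-- The projection of a Lie algebra onto its quotient by an ideal, as a linear map. -/
def quotientMk (I : LieIdeal k 𝔤) : 𝔤 →ₗ[k] 𝔤 ⧸ I :=
  (LieSubmodule.Quotient.mk' I : 𝔤 →ₗ[k] 𝔤 ⧸ I)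

theorem quotientMk_surjective (I : LieIdeal k 𝔤) : Function.Surjective (quotientMk I) :=
  LieSubmodule.Quotient.surjective_mk' I

theorem quotientMk_eq_zero {I : LieIdeal k 𝔤} {x : 𝔤} : quotientMk I x = 0 ↔ x ∈ I :=
  LieSubmodule.Quotient.mk_eq_zero I

theorem quotientMk_lie (I : LieIdeal k 𝔤) (x y : 𝔤) :
    quotientMk I ⁅x, y⁆ = ⁅quotientMk I x, quotientMk I y⁆ :=
  LieSubmodule.Quotient.mk_bracket I x y

theorem quotientMk_eq_iff {I : LieIdeal k 𝔤} {x y : 𝔤} :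
    quotientMk I x = quotientMk I y ↔ x - y ∈ I := by
  rw [← sub_eq_zero, ← map_sub, quotientMk_eq_zero]

/-- Ideals of the quotient pull back to ideals containing `I`. Perfectness excludes a commutative
quotient, for which `I` would contain `[𝔤, 𝔤] = 𝔤`. -/
theorem isSimple_quotient_of_isCoatom {I : LieIdeal k 𝔤} (hI : IsCoatom I)
    (h : ⁅(⊤ : LieIdeal k 𝔤), (⊤ : LieIdeal k 𝔤)⁆ = ⊤) : LieAlgebra.IsSimple k (𝔤 ⧸ I) where
  eq_bot_or_eq_top J := by
    let J' : LieIdeal k 𝔤 :=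
      { J.toSubmodule.comap (quotientMk I) with
        lie_mem := fun {x m} hm ↦ by
          change quotientMk I ⁅x, m⁆ ∈ J
          rw [quotientMk_lie]
          exact J.lie_mem hm }
    have hJ' (x : 𝔤) : x ∈ J' ↔ quotientMk I x ∈ J := Iff.rfl
    have hle : I ≤ J' := fun x hx ↦ by
      rw [hJ', quotientMk_eq_zero.2 hx]; exact zero_mem J
    rcases hI.le_iff.1 hle with h | h
    · right
      refine eq_top_iff.2 fun x _ ↦ ?_
      obtain ⟨x, rfl⟩ := quotientMk_surjective I x
      exact (hJ' x).1 (h ▸ LieSubmodule.mem_top x)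
    · left
      refine eq_bot_iff.2 fun x hx ↦ ?_
      obtain ⟨x, rfl⟩ := quotientMk_surjective I x
      have : x ∈ I := h ▸ (hJ' x).2 hx
      simpa [quotientMk_eq_zero] using this
  non_abelian hab := by
    refine hI.1 (eq_top_iff.2 ?_)
    rw [← h, LieSubmodule.lie_le_iff]
    intro x _ y _
    rw [← quotientMk_eq_zero, quotientMk_lie]
    exact hab.trivial _ _

end Quotient

section Decomposition

variable {ι k M : Type*} [DecidableEq ι] [Fintype ι] [CommRing k] [AddCommGroup M] [Module k M]

/-- A complete family of projections gives a decomposition. -/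
theorem nonempty_decomposition_of_proj (ℬ : ι → Submodule k M) (p : ι → M →ₗ[k] M)
    (hmem : ∀ i x, p i x ∈ ℬ i) (hsum : ∀ x, ∑ i, p i x = x)
    (hself : ∀ i, ∀ x ∈ ℬ i, p i x = x) (hne : ∀ i j, i ≠ j → ∀ x ∈ ℬ i, p j x = 0) :
    Nonempty (DirectSum.Decomposition ℬ) :=
  ⟨DirectSum.Decomposition.ofLinearMap ℬ
    (∑ i, DirectSum.lof k ι (fun i ↦ ℬ i) i ∘ₗ (p i).codRestrict (ℬ i) (hmem i))
    (by
      ext x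
      simp [hsum])
    (by
      ext i x : 2
      simp only [LinearMap.comp_apply, LinearMap.sum_apply, DirectSum.coeLinearMap_lof,
        LinearMap.id_apply]
      rw [Finset.sum_eq_single i]
      · congr 1
        exact Subtype.ext (hself i x x.2)
      · intro j _ hj
        have : (p j).codRestrict (ℬ j) (hmem j) x = 0 := Subtype.ext (hne i j hj.symm x x.2)
        rw [this, map_zero]
      · simp)⟩

end Decomposition

/-! ### Realization as a loop algebra over a quotient. -/

section LoopRealization

variable {Q : Type u} {k : Type v} {𝔤 : Type w} [AddCommGroup Q] [Fintype Q] [DecidableEq Q]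
  [CommRing k] [LieRing 𝔤] [LieAlgebra k 𝔤] (𝒜 : Q → Submodule k 𝔤) [GradedLieAlgebra 𝒜]

/-- The Lie homomorphism `x ↦ ∑ α, t ^ α ⊗ x_α` into the extension of scalars of a quotient. -/
noncomputable def loopHom (I : LieIdeal k 𝔤) :
    𝔤 →ₗ⁅k⁆ AddMonoidAlgebra k Q ⊗[k] (𝔤 ⧸ I) where
  toLinearMap := ∑ α, TensorProduct.mk k (AddMonoidAlgebra k Q) (𝔤 ⧸ I)
    (AddMonoidAlgebra.single α 1) ∘ₗ quotientMk I ∘ₗ gproj 𝒜 α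
  map_lie' {x y} := by
    have key (α : Q) (x : 𝔤) (hx : x ∈ 𝒜 α) : (∑ α, TensorProduct.mk k (AddMonoidAlgebra k Q)
        (𝔤 ⧸ I) (AddMonoidAlgebra.single α 1) ∘ₗ quotientMk I ∘ₗ gproj 𝒜 α) x =
        (AddMonoidAlgebra.single α (1 : k)) ⊗ₜ[k] quotientMk I x := by
      rw [LinearMap.sum_apply, Finset.sum_eq_single α]
      · simp [gproj_of_mem hx]
      · intro β _ hβ
        simp [gproj_of_mem_ne hx hβ.symm]
      · simp
    generalize (∑ α, TensorProduct.mk k (AddMonoidAlgebra k Q) (𝔤 ⧸ I)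
      (AddMonoidAlgebra.single α 1) ∘ₗ quotientMk I ∘ₗ gproj 𝒜 α) = f at key
    change f ⁅x, y⁆ = ⁅f x, f y⁆
    rw [← sum_gproj 𝒜 x, ← sum_gproj 𝒜 y]
    simp only [sum_lie_sum, map_sum]
    refine Finset.sum_congr rfl fun α _ ↦ ?_
    refine Finset.sum_congr rfl fun β _ ↦ ?_
    have hα := gproj_mem 𝒜 α x
    have hβ := gproj_mem 𝒜 β y
    rw [key α _ hα, key β _ hβ, key (α + β) _ (SetLike.GradedBracket.bracket_mem hα hβ),
      quotientMk_lie]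
    simp [AddMonoidAlgebra.single_mul_single]

theorem loopHom_apply (I : LieIdeal k 𝔤) (x : 𝔤) : loopHom 𝒜 I x =
    ∑ α, (AddMonoidAlgebra.single α (1 : k)) ⊗ₜ[k] quotientMk I (gproj 𝒜 α x) := by
  change (∑ α, TensorProduct.mk k (AddMonoidAlgebra k Q) (𝔤 ⧸ I)
    (AddMonoidAlgebra.single α 1) ∘ₗ quotientMk I ∘ₗ gproj 𝒜 α) x = _
  simp

theorem loopHom_of_mem (I : LieIdeal k 𝔤) {α : Q} {x : 𝔤} (hx : x ∈ 𝒜 α) : loopHom 𝒜 I x =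
    (AddMonoidAlgebra.single α (1 : k)) ⊗ₜ[k] quotientMk I x := by
  rw [loopHom_apply, Finset.sum_eq_single α]
  · rw [gproj_of_mem hx]
  · intro β _ hβ
    rw [gproj_of_mem_ne hx hβ.symm, map_zero, TensorProduct.tmul_zero]
  · simp

/-- An element of the kernel has all its components in `I`, and the homogeneous core of a proper
ideal is zero. Maximality of `I` plays no role here. -/
theorem loopHom_injective [IsGradedSimpleLie 𝒜] {I : LieIdeal k 𝔤} (hI : I ≠ ⊤) :
    Function.Injective (loopHom 𝒜 I) := by
  rw [injective_iff_map_eq_zero]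
  intro x hx
  refine eq_zero_of_forall_gproj_mem 𝒜 hI fun α ↦ ?_
  rw [← quotientMk_eq_zero]
  have h := congrArg (fun z : AddMonoidAlgebra k Q ⊗[k] (𝔤 ⧸ I) ↦
    LieAlgebra.LoopAlgebra.toFinsupp k Q (𝔤 ⧸ I) z α) hx
  rw [loopHom_apply] at h
  simpa [Finsupp.single_apply, Finsupp.finsetSum_apply] using h

open GradedLoop in
/-- A graded simple Lie algebra is a loop algebra over its quotient by a maximal ideal that is
graded modulo `P` and whose quotient identifies the components of degrees congruent modulo `P`. -/
theorem exists_gradedLieIso_of_isCoatom [IsGradedSimpleLie 𝒜] (P : AddSubgroup Q)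
    [DecidableEq (Q ⧸ P)] {I : LieIdeal k 𝔤} (hI : IsCoatom I)
    (hgr : ∀ c : Q ⧸ P, ∀ x ∈ I, (∑ α : Q with (QuotientAddGroup.mk α : Q ⧸ P) = c, gproj 𝒜 α x) ∈ I)
    (hcong : ∀ α β : Q, β - α ∈ P → ∀ x ∈ 𝒜 β, ∃ y ∈ 𝒜 α, x - y ∈ I) :
    ∃ (𝔞 : Type w) (_ : LieRing 𝔞) (_ : LieAlgebra k 𝔞)
      (ℬ : Q ⧸ P → Submodule k 𝔞) (_ : GradedLieAlgebra ℬ),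
      LieAlgebra.IsSimple k 𝔞 ∧ Nonempty (GradedLieIso 𝒜 (GradedLoop.grading P ℬ)) := by
  -- The choice of representative is immaterial: by `hcong`, congruent degrees have the same image.
  let ℬ : Q ⧸ P → Submodule k (𝔤 ⧸ I) := fun c ↦ (𝒜 c.out).map (quotientMk I)
  have hle (α β : Q) (h : β - α ∈ P) :
      (𝒜 β).map (quotientMk I) ≤ (𝒜 α).map (quotientMk I) := by
    rintro _ ⟨x, hx, rfl⟩
    obtain ⟨y, hy, hxy⟩ := hcong α β h x hx
    exact ⟨y, hy, (quotientMk_eq_iff.2 hxy).symm⟩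
  have hℬ (α : Q) : ℬ α = (𝒜 α).map (quotientMk I) := by
    have h1 : -(Quotient.out (α : Q ⧸ P)) + α ∈ P := QuotientAddGroup.eq.1 (by simp)
    refine le_antisymm (hle _ _ ?_) (hle _ _ ?_)
    · simpa [neg_add_eq_sub] using neg_mem h1
    · simpa [neg_add_eq_sub] using h1
  have : SetLike.GradedBracket ℬ :=
    { bracket_mem := by
        intro c d x y hx hy
        induction c using QuotientAddGroup.induction_on with | H α => ?_
        induction d using QuotientAddGroup.induction_on with | H β => ?_
        rw [hℬ] at hx hy
        rw [← QuotientAddGroup.mk_add, hℬ]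
        obtain ⟨x, hx, rfl⟩ := hx
        obtain ⟨y, hy, rfl⟩ := hy
        exact ⟨⁅x, y⁆, SetLike.GradedBracket.bracket_mem hx hy, quotientMk_lie I x y⟩ }
  let q : Q ⧸ P → 𝔤 →ₗ[k] 𝔤 := fun c ↦ ∑ α : Q with (QuotientAddGroup.mk α : Q ⧸ P) = c, gproj 𝒜 α
  have hq (c : Q ⧸ P) (x : 𝔤) : q c x = ∑ α : Q with (QuotientAddGroup.mk α : Q ⧸ P) = c, gproj 𝒜 α x := by
    simp [q]
  -- By `hgr` the projection onto the degrees in a coset preserves `I`, so it descends to the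
  -- quotient.
  let p : Q ⧸ P → (𝔤 ⧸ I) →ₗ[k] (𝔤 ⧸ I) := fun c ↦
    I.toSubmodule.mapQ I.toSubmodule (q c) fun x hx ↦ by
      rw [Submodule.mem_comap, hq]; exact hgr c x hx
  have hp (c : Q ⧸ P) (x : 𝔤) : p c (quotientMk I x) = quotientMk I (q c x) := rfl
  have hqhom (α : Q) (c : Q ⧸ P) (x : 𝔤) (hx : x ∈ 𝒜 α) :
      q c x = if (α : Q ⧸ P) = c then x else 0 := by
    rw [hq, Finset.sum_filter, Finset.sum_eq_single α]
    · rw [gproj_of_mem hx]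
    · intro β _ hβ
      rw [gproj_of_mem_ne hx hβ.symm, ite_self]
    · simp
  have : Fintype (Q ⧸ P) := Fintype.ofFinite _
  obtain ⟨hdec⟩ : Nonempty (DirectSum.Decomposition ℬ) := by
    refine nonempty_decomposition_of_proj ℬ p ?_ ?_ ?_ ?_
    · intro c x
      obtain ⟨x, rfl⟩ := quotientMk_surjective I x
      rw [hp, hq, map_sum]
      refine Submodule.sum_mem _ fun α hα ↦ ?_
      rw [Finset.mem_filter] at hα
      rw [← hα.2, hℬ]
      exact ⟨_, gproj_mem 𝒜 α x, rfl⟩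
    · intro x
      obtain ⟨x, rfl⟩ := quotientMk_surjective I x
      simp only [hp, ← map_sum]
      congr 1
      simp only [hq]
      rw [Finset.sum_fiberwise, sum_gproj]
    · intro c x hx
      induction c using QuotientAddGroup.induction_on with | H α => ?_
      rw [hℬ] at hx
      obtain ⟨x, hx, rfl⟩ := hx
      rw [hp, hqhom α _ x hx, if_pos rfl]
    · intro c d hcd x hx
      induction c using QuotientAddGroup.induction_on with | H α => ?_
      rw [hℬ] at hx
      obtain ⟨x, hx, rfl⟩ := hx
      rw [hp, hqhom α _ x hx, if_neg hcd, map_zero]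
  refine ⟨𝔤 ⧸ I, inferInstance, inferInstance, ℬ, { toDecomposition := hdec },
    isSimple_quotient_of_isCoatom hI (lie_top_top_eq_top 𝒜), ?_⟩
  have hmap (α : Q) : (𝒜 α).map (loopHom 𝒜 I : 𝔤 →ₗ[k] AddMonoidAlgebra k Q ⊗[k] (𝔤 ⧸ I)) = component P ℬ α := by
    rw [component, hℬ, ← Submodule.map_comp]
    ext z
    simp only [Submodule.mem_map]
    refine exists_congr fun x ↦ and_congr_right fun hx ↦ ?_
    have := loopHom_of_mem 𝒜 I hx
    simp [this]
  have hrange : ((loopHom 𝒜 I).range : Set (AddMonoidAlgebra k Q ⊗[k] (𝔤 ⧸ I))) =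
      algebra P ℬ := by
    have htop : (⨆ α, 𝒜 α) = ⊤ :=
      (DirectSum.Decomposition.isInternal 𝒜).submodule_iSup_eq_top
    have : LinearMap.range (loopHom 𝒜 I : 𝔤 →ₗ[k] AddMonoidAlgebra k Q ⊗[k] (𝔤 ⧸ I)) = (algebra P ℬ).toSubmodule := by
      rw [LinearMap.range_eq_map, ← htop, Submodule.map_iSup]
      simp only [hmap]
      rfl
    exact Set.ext fun z ↦ SetLike.ext_iff.1 this z
  let e := (LieEquiv.ofInjective (loopHom 𝒜 I) (loopHom_injective 𝒜 hI.1)).trans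
    (LieEquiv.ofEq _ _ hrange)
  have he (x : 𝔤) : ((e x : algebra P ℬ) : AddMonoidAlgebra k Q ⊗[k] (𝔤 ⧸ I)) =
    loopHom 𝒜 I x := rfl
  refine ⟨{ e with map_component := fun α ↦ ?_ }⟩
  ext z
  constructor
  · rintro ⟨x, hx, rfl⟩
    change ((e x : algebra P ℬ) : AddMonoidAlgebra k Q ⊗[k] (𝔤 ⧸ I)) ∈ component P ℬ α
    rw [he, ← hmap]
    exact ⟨x, hx, rfl⟩
  · intro hz
    replace hz : (z : AddMonoidAlgebra k Q ⊗[k] (𝔤 ⧸ I)) ∈ component P ℬ α := hz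
    rw [← hmap] at hz
    obtain ⟨x, hx, hxz⟩ := hz
    exact ⟨x, hx, Subtype.ext hxz⟩

end LoopRealization

/-! ### Primeness and existence of maximal ideals. -/

/-- If neither `A` nor `B` lies in `I`, then `I + A = I + B = 𝔤`, so `𝔤 = [I + A, I + B] ⊆ I + A ∩
B`. -/
theorem infPrime_of_isCoatom {k 𝔤 : Type*} [CommRing k] [LieRing 𝔤] [LieAlgebra k 𝔤]
    (h : ⁅(⊤ : LieIdeal k 𝔤), (⊤ : LieIdeal k 𝔤)⁆ = ⊤) {I : LieIdeal k 𝔤} (hI : IsCoatom I) :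
    InfPrime I := by
  refine ⟨fun hmax ↦ hI.1 hmax.eq_top, fun A B hAB ↦ ?_⟩
  by_contra! hcon
  have hA : I ⊔ A = ⊤ := hI.2 _ (left_lt_sup.2 hcon.1)
  have hB : I ⊔ B = ⊤ := hI.2 _ (left_lt_sup.2 hcon.2)
  refine hI.1 (eq_top_iff.2 ?_)
  rw [← h]
  nth_rewrite 1 [← hA]
  rw [LieSubmodule.sup_lie]
  refine sup_le (LieSubmodule.lie_le_left _ _) ?_
  rw [← hB, LieSubmodule.lie_sup]
  refine sup_le (LieSubmodule.lie_le_right _ _) ?_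
  exact (le_inf (LieSubmodule.lie_le_left _ _) (LieSubmodule.lie_le_right _ _)).trans hAB

/-- A single nonzero homogeneous element generates `𝔤`, so the top ideal is compact and Zorn's lemma
applies in any dimension. -/
theorem exists_isCoatom {Q k 𝔤 : Type*} [AddCommGroup Q] [CommRing k] [LieRing 𝔤]
    [LieAlgebra k 𝔤] [DecidableEq Q] [Fintype Q] (𝒜 : Q → Submodule k 𝔤) [GradedLieAlgebra 𝒜]
    [IsGradedSimpleLie 𝒜] : ∃ I : LieIdeal k 𝔤, IsCoatom I := by
  obtain ⟨α, x, hx, hx0⟩ := exists_homogeneous_ne_zero 𝒜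
  have htop : LieSubmodule.lieSpan k 𝔤 {x} = ⊤ :=
    eq_top_of_homogeneous_mem hx hx0 (LieSubmodule.subset_lieSpan rfl)
  have hc : IsCompactElement (⊤ : LieIdeal k 𝔤) :=
    htop ▸ LieSubmodule.isCompactElement_lieSpan_singleton _ _ x
  have := CompleteLattice.coatomic_of_top_compact hc
  have hne : (⊥ : LieIdeal k 𝔤) ≠ ⊤ := fun h ↦
    hx0 (by simpa [← h] using LieSubmodule.mem_top (R := k) (L := 𝔤) x)
  obtain ⟨I, hI, -⟩ := (eq_top_or_exists_le_coatom (⊥ : LieIdeal k 𝔤)).resolve_left hne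
  exact ⟨I, hI⟩

/-! ### The action of the characters of `Q`. -/

section CharacterAction

variable {Q : Type u} {k : Type v} {𝔤 : Type w} [AddCommGroup Q] [Fintype Q] [DecidableEq Q]
  [Field k] [LieRing 𝔤] [LieAlgebra k 𝔤] (𝒜 : Q → Submodule k 𝔤) [GradedLieAlgebra 𝒜]

/-- The value of a character at a degree. -/
abbrev charValue (χ : Multiplicative Q →* kˣ) (α : Q) : k := (χ (Multiplicative.ofAdd α) : k)

/-- The action of a character of the grading group on a graded Lie algebra. -/
noncomputable def charAction (χ : Multiplicative Q →* kˣ) : 𝔤 →ₗ⁅k⁆ 𝔤 where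
  toLinearMap := ∑ α, charValue χ α • gproj 𝒜 α
  map_lie' {x y} := by
    have key (α : Q) (x : 𝔤) (hx : x ∈ 𝒜 α) :
        (∑ α, charValue χ α • gproj 𝒜 α) x = charValue χ α • x := by
      rw [LinearMap.sum_apply, Finset.sum_eq_single α]
      · simp [gproj_of_mem hx]
      · intro β _ hβ
        simp [gproj_of_mem_ne hx hβ.symm]
      · simp
    generalize (∑ α, charValue χ α • gproj 𝒜 α) = f at key
    change f ⁅x, y⁆ = ⁅f x, f y⁆
    rw [← sum_gproj 𝒜 x, ← sum_gproj 𝒜 y]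
    simp only [sum_lie_sum, map_sum]
    refine Finset.sum_congr rfl fun α _ ↦ ?_
    refine Finset.sum_congr rfl fun β _ ↦ ?_
    have hα := gproj_mem 𝒜 α x
    have hβ := gproj_mem 𝒜 β y
    rw [key α _ hα, key β _ hβ, key (α + β) _ (SetLike.GradedBracket.bracket_mem hα hβ),
      smul_lie, lie_smul, smul_smul, charValue, ofAdd_add, map_mul, Units.val_mul]

theorem charAction_apply (χ : Multiplicative Q →* kˣ) (x : 𝔤) :
    charAction 𝒜 χ x = ∑ α, charValue χ α • gproj 𝒜 α x := by
  change (∑ α, charValue χ α • gproj 𝒜 α) x = _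
  simp

theorem charAction_of_mem (χ : Multiplicative Q →* kˣ) {α : Q} {x : 𝔤} (hx : x ∈ 𝒜 α) :
    charAction 𝒜 χ x = charValue χ α • x := by
  rw [charAction_apply, Finset.sum_eq_single α]
  · rw [gproj_of_mem hx]
  · intro β _ hβ
    rw [gproj_of_mem_ne hx hβ.symm, smul_zero]
  · simp

theorem charAction_mul (χ ψ : Multiplicative Q →* kˣ) (x : 𝔤) :
    charAction 𝒜 (χ * ψ) x = charAction 𝒜 χ (charAction 𝒜 ψ x) := by
  rw [← sum_gproj 𝒜 x]
  simp only [map_sum]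
  refine Finset.sum_congr rfl fun α _ ↦ ?_
  have h := gproj_mem 𝒜 α x
  rw [charAction_of_mem 𝒜 _ h, charAction_of_mem 𝒜 ψ h, map_smul, charAction_of_mem 𝒜 _ h,
    smul_smul, charValue, charValue, charValue, MonoidHom.mul_apply, Units.val_mul, mul_comm]

theorem charAction_one (x : 𝔤) : charAction 𝒜 (1 : Multiplicative Q →* kˣ) x = x := by
  have (α : Q) : charValue (1 : Multiplicative Q →* kˣ) α = 1 := rfl
  simp [charAction_apply, this, sum_gproj]

/-- The translate of an ideal under a character of the grading group. -/
noncomputable def charTranslate (χ : Multiplicative Q →* kˣ) (I : LieIdeal k 𝔤) : LieIdeal k 𝔤 :=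
  I.comap (charAction 𝒜 χ)

theorem mem_charTranslate {χ : Multiplicative Q →* kˣ} {I : LieIdeal k 𝔤} {x : 𝔤} :
    x ∈ charTranslate 𝒜 χ I ↔ charAction 𝒜 χ x ∈ I := LieIdeal.mem_comap

theorem charTranslate_mul (χ ψ : Multiplicative Q →* kˣ) (I : LieIdeal k 𝔤) :
    charTranslate 𝒜 (χ * ψ) I = charTranslate 𝒜 χ (charTranslate 𝒜 ψ I) := by
  ext x
  rw [mem_charTranslate, mem_charTranslate, mem_charTranslate,
    (mul_comm χ ψ : χ * ψ = ψ * χ), charAction_mul]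

theorem charTranslate_one (I : LieIdeal k 𝔤) : charTranslate 𝒜 1 I = I := by
  ext x
  rw [mem_charTranslate, charAction_one]

theorem charTranslate_mono (χ : Multiplicative Q →* kˣ) {I J : LieIdeal k 𝔤} (h : I ≤ J) :
    charTranslate 𝒜 χ I ≤ charTranslate 𝒜 χ J := LieIdeal.comap_mono h

theorem isCoatom_charTranslate (χ : Multiplicative Q →* kˣ) {I : LieIdeal k 𝔤} (hI : IsCoatom I) :
    IsCoatom (charTranslate 𝒜 χ I) := by
  have hinv (χ : Multiplicative Q →* kˣ) (J : LieIdeal k 𝔤) :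
      charTranslate 𝒜 χ (charTranslate 𝒜 χ⁻¹ J) = J := by
    rw [← charTranslate_mul, (mul_inv_cancel χ : χ * χ⁻¹ = 1), charTranslate_one]
  have hinv' (J : LieIdeal k 𝔤) : charTranslate 𝒜 χ⁻¹ (charTranslate 𝒜 χ J) = J := by
    rw [← charTranslate_mul, (inv_mul_cancel χ : χ⁻¹ * χ = 1), charTranslate_one]
  let e : LieIdeal k 𝔤 ≃o LieIdeal k 𝔤 :=
    { toFun := charTranslate 𝒜 χ
      invFun := charTranslate 𝒜 χ⁻¹
      left_inv := hinv'
      right_inv := hinv χ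
      map_rel_iff' {A B} := ⟨fun h ↦ by
        have := charTranslate_mono 𝒜 χ⁻¹ h
        simpa [hinv'] using this, charTranslate_mono 𝒜 χ⟩ }
  exact (e.isCoatom_iff I).2 hI

/-- The characters that stabilize an ideal. -/
noncomputable def charStabilizer (I : LieIdeal k 𝔤) : Subgroup (Multiplicative Q →* kˣ) where
  carrier := {χ | charTranslate 𝒜 χ I = I}
  mul_mem' {χ ψ} hχ hψ := by
    simp only [Set.mem_ofPred_eq] at hχ hψ ⊢
    rw [charTranslate_mul, hψ, hχ]
  one_mem' := charTranslate_one 𝒜 I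
  inv_mem' {χ} hχ := by
    simp only [Set.mem_ofPred_eq] at hχ ⊢
    conv_lhs => rw [← hχ]
    rw [← charTranslate_mul, (inv_mul_cancel χ : χ⁻¹ * χ = 1), charTranslate_one]

theorem mem_charStabilizer {I : LieIdeal k 𝔤} {χ : Multiplicative Q →* kˣ} :
    χ ∈ charStabilizer 𝒜 I ↔ charTranslate 𝒜 χ I = I := Iff.rfl

end CharacterAction

/-- The degrees on which all characters of a subgroup are trivial. -/
def charAnnihilator {Q k : Type*} [AddCommGroup Q] [Field k]
    (H : Subgroup (Multiplicative Q →* kˣ)) : AddSubgroup Q where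
  carrier := {α | ∀ χ ∈ H, χ (Multiplicative.ofAdd α) = 1}
  add_mem' {a b} ha hb χ hχ := by rw [ofAdd_add, map_mul, ha χ hχ, hb χ hχ, one_mul]
  zero_mem' χ _ := by rw [ofAdd_zero, map_one]
  neg_mem' {a} ha χ hχ := by rw [ofAdd_neg, map_inv, ha χ hχ, inv_one]

-- Orthogonality of characters: evaluation at `α` is a homomorphism from `H` to a field, whose sum
-- vanishes unless it is trivial.
open scoped Classical in
theorem sum_charValue {Q k : Type*} [AddCommGroup Q] [Field k]
    (H : Subgroup (Multiplicative Q →* kˣ)) [Fintype H] (α : Q) :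
    ∑ χ : H, charValue χ.1 α = if α ∈ charAnnihilator H then (Fintype.card H : k) else 0 := by
  let f : H →* k := (Units.coeHom k).comp
    ((MonoidHom.eval (Multiplicative.ofAdd α)).comp H.subtype)
  have hf (χ : H) : f χ = charValue χ.1 α := rfl
  split_ifs with h
  · have : ∀ χ : H, charValue χ.1 α = 1 := fun χ ↦ by rw [charValue, h χ.1 χ.2, Units.val_one]
    simp [this]
  · simp only [← hf]
    refine sum_hom_units_eq_zero f fun h1 ↦ h fun χ hχ ↦ ?_
    have : f ⟨χ, hχ⟩ = 1 := by rw [h1]; rfl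
    rw [hf] at this
    exact Units.ext this

/-! ### The case of a primitive root of unity. -/

section Roots

variable {Q : Type u} {k : Type v} [AddCommGroup Q] [Finite Q] [Field k] {ζ : k}

theorem hasEnoughRootsOfUnity_exponent (hζ : IsPrimitiveRoot ζ (Nat.card Q)) :
    HasEnoughRootsOfUnity k (Monoid.exponent (Multiplicative Q)) := by
  have : NeZero (Nat.card Q) := ⟨Nat.card_pos.ne'⟩
  have : HasEnoughRootsOfUnity k (Nat.card Q) := ⟨⟨ζ, hζ⟩, inferInstance⟩
  exact HasEnoughRootsOfUnity.of_dvd k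
    (n := Nat.card Q) (Group.exponent_dvd_nat_card (G := Multiplicative Q))

/-- There are `|Q|` characters, and a primitive root of order `|Q|` can exist only if `|Q|` is
invertible in `k`. This permits averaging. -/
theorem card_char_ne_zero (hζ : IsPrimitiveRoot ζ (Nat.card Q)) :
    (Nat.card (Multiplicative Q →* kˣ) : k) ≠ 0 := by
  have := hasEnoughRootsOfUnity_exponent hζ
  rw [CommGroup.card_monoidHom_of_hasEnoughRootsOfUnity]
  have : NeZero (Nat.card Q) := ⟨Nat.card_pos.ne'⟩
  exact (hζ.neZero').ne

theorem charAnnihilator_top (hζ : IsPrimitiveRoot ζ (Nat.card Q)) :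
    charAnnihilator (⊤ : Subgroup (Multiplicative Q →* kˣ)) = ⊥ := by
  have := hasEnoughRootsOfUnity_exponent hζ
  rw [eq_bot_iff]
  intro α hα
  by_contra h
  obtain ⟨χ, hχ⟩ := CommGroup.exists_apply_ne_one_of_hasEnoughRootsOfUnity (Multiplicative Q) k
    (a := Multiplicative.ofAdd α) (by simpa using h)
  exact hχ (hα χ trivial)

variable {𝔤 : Type w} [DecidableEq Q] [LieRing 𝔤] [LieAlgebra k 𝔤]

open scoped Classical in
theorem exists_gradedLieIso_of_isPrimitiveRoot (𝒜 : Q → Submodule k 𝔤) [GradedLieAlgebra 𝒜]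
    [IsGradedSimpleLie 𝒜] (hζ : IsPrimitiveRoot ζ (Nat.card Q)) :
    ∃ (P : AddSubgroup Q) (𝔞 : Type w) (_ : LieRing 𝔞) (_ : LieAlgebra k 𝔞)
      (ℬ : Q ⧸ P → Submodule k 𝔞) (_ : GradedLieAlgebra ℬ),
      LieAlgebra.IsSimple k 𝔞 ∧ Nonempty (GradedLieIso 𝒜 (GradedLoop.grading P ℬ)) := by
  have : Fintype Q := Fintype.ofFinite Q
  have : Fintype (Multiplicative Q →* kˣ) := Fintype.ofFinite _
  obtain ⟨I, hI⟩ := exists_isCoatom 𝒜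
  set H := charStabilizer 𝒜 I
  have hstab {χ} (hχ : χ ∈ H) {x : 𝔤} (hx : x ∈ I) : charAction 𝒜 χ x ∈ I := by
    rw [← mem_charTranslate, (mem_charStabilizer 𝒜).1 hχ]; exact hx
  have hcardH : (Fintype.card H : k) ≠ 0 := fun h ↦ by
    apply card_char_ne_zero hζ
    obtain ⟨c, hc⟩ := Subgroup.card_subgroup_dvd_card H
    rw [hc, Nat.cast_mul, Nat.card_eq_fintype_card, h, zero_mul]
  -- averaging over a subgroup of characters
  have havg (K : Subgroup (Multiplicative Q →* kˣ)) (α : Q) (x : 𝔤) :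
      ∑ χ : K, charValue χ.1 (-α) • charAction 𝒜 χ.1 x =
        ∑ γ, (∑ χ : K, charValue χ.1 (γ - α)) • gproj 𝒜 γ x := by
    simp only [charAction_apply, Finset.smul_sum, Finset.sum_smul]
    rw [Finset.sum_comm]
    refine Finset.sum_congr rfl fun γ _ ↦ Finset.sum_congr rfl fun χ _ ↦ ?_
    rw [smul_smul, charValue, charValue, charValue, ← Units.val_mul, ← map_mul, ← ofAdd_add,
      neg_add_eq_sub]
  refine ⟨charAnnihilator H, exists_gradedLieIso_of_isCoatom 𝒜 _ hI ?_ ?_⟩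
  · intro c x hx
    induction c using QuotientAddGroup.induction_on with | H α => ?_
    -- By orthogonality, `|H|` times the projection onto the coset of `α` is a combination of
    -- automorphisms preserving `I`.
    have h1 : (Fintype.card H : k) •
        (∑ γ : Q with (QuotientAddGroup.mk γ : Q ⧸ charAnnihilator H) = α, gproj 𝒜 γ x) =
        ∑ χ : H, charValue χ.1 (-α) • charAction 𝒜 χ.1 x := by
      rw [havg, Finset.smul_sum, Finset.sum_filter]
      refine Finset.sum_congr rfl fun γ _ ↦ ?_
      rw [sum_charValue, ite_smul, zero_smul]
      refine if_congr ?_ rfl rfl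
      rw [eq_comm, QuotientAddGroup.eq, neg_add_eq_sub]
    rw [← inv_smul_smul₀ hcardH (∑ γ : Q with
      (QuotientAddGroup.mk γ : Q ⧸ charAnnihilator H) = α, gproj 𝒜 γ x), h1]
    exact I.smul_mem _ (sum_mem fun χ _ ↦ I.smul_mem _ (hstab χ.2 hx))
  · intro α β hαβ x hx
    -- Translates of `I` by characters outside `H` are maximal ideals other than `I`, so none lies
    -- in `I`; by primeness neither does their intersection `J`.
    let S : Finset (Multiplicative Q →* kˣ) := Finset.univ.filter (· ∉ H)
    let J : LieIdeal k 𝔤 := S.inf fun χ ↦ charTranslate 𝒜 χ I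
    have hJ : ¬ J ≤ I := by
      rw [(infPrime_of_isCoatom (lie_top_top_eq_top 𝒜) hI).finset_inf_le]
      rintro ⟨χ, hχ, hle⟩
      refine (Finset.mem_filter.1 hχ).2 ?_
      exact ((isCoatom_charTranslate 𝒜 χ hI).le_iff_eq hI.1).1 hle |>.symm
    have htop : I ⊔ J = ⊤ := hI.2 _ (left_lt_sup.2 hJ)
    obtain ⟨i, hi, j, hj, rfl⟩ := LieSubmodule.mem_sup _ _ _ |>.1
      (htop ▸ LieSubmodule.mem_top x : x ∈ I ⊔ J)
    have hJS {χ} (hχ : χ ∉ H) : charAction 𝒜 χ j ∈ I := by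
      rw [← mem_charTranslate]
      exact (Finset.inf_le (f := fun χ ↦ charTranslate 𝒜 χ I)
        (Finset.mem_filter.2 ⟨Finset.mem_univ χ, hχ⟩) : J ≤ _) hj
    -- For `χ ∈ H`, twisting by `χ(-α)` fixes `i + j`, of degree `β`, because `χ(β - α) = 1`; and it
    -- keeps `i` in `I`.
    have hJH {χ} (hχ : χ ∈ H) :
        charValue χ (-α) • charAction 𝒜 χ j - (i + j) ∈ I := by
      have h1 : charValue χ (-α) • charAction 𝒜 χ (i + j) = i + j := by
        rw [charAction_of_mem 𝒜 χ hx, smul_smul, charValue, charValue, ← Units.val_mul,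
          ← map_mul, ← ofAdd_add, neg_add_eq_sub, hαβ χ hχ, Units.val_one, one_smul]
      have h2 : charValue χ (-α) • charAction 𝒜 χ j - (i + j) =
          -(charValue χ (-α) • charAction 𝒜 χ i) := by
        nth_rewrite 1 [← h1]
        rw [map_add, smul_add]
        abel
      rw [h2]
      exact neg_mem (I.smul_mem _ (hstab hχ hi))
    -- No nonzero degree is killed by all characters, so averaging over all of them isolates the
    -- component of degree `α`.
    have hG : ∑ χ, charValue χ (-α) • charAction 𝒜 χ j =
        (Nat.card (Multiplicative Q →* kˣ) : k) • gproj 𝒜 α j := by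
      have h1 := havg ⊤ α j
      rw [Finset.sum_eq_single α] at h1
      · rw [sum_charValue, if_pos (by rw [sub_self]; exact zero_mem _),
          ← Nat.card_eq_fintype_card, Subgroup.card_top] at h1
        rw [← h1]
        exact (Equiv.sum_comp Subgroup.topEquiv.toEquiv
          fun χ ↦ charValue χ (-α) • charAction 𝒜 χ j).symm
      · intro γ _ hγ
        rw [sum_charValue, if_neg, zero_smul]
        rw [charAnnihilator_top hζ]
        simpa [sub_eq_zero] using hγ
      · simp
    have hsplit : ∑ χ, charValue χ (-α) • charAction 𝒜 χ j - (Fintype.card H : k) • (i + j) =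
        ∑ χ : H, (charValue χ.1 (-α) • charAction 𝒜 χ.1 j - (i + j)) +
        ∑ χ ∈ S, charValue χ (-α) • charAction 𝒜 χ j := by
      rw [Finset.sum_sub_distrib, Finset.sum_const, Finset.card_univ, Nat.cast_smul_eq_nsmul,
        sub_add_eq_add_sub, ← Finset.sum_filter_add_sum_filter_not Finset.univ (· ∈ H)]
      congr 2
      exact Finset.sum_subtype _ (by simp) _
    have hmem : ∑ χ, charValue χ (-α) • charAction 𝒜 χ j - (Fintype.card H : k) • (i + j) ∈ I := by
      rw [hsplit]
      exact add_mem (sum_mem fun χ _ ↦ hJH χ.2)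
        (sum_mem fun χ hχ ↦ I.smul_mem _ (hJS (Finset.mem_filter.1 hχ).2))
    rw [hG] at hmem
    -- Modulo `I`, each term with `χ ∈ H` equals `i + j` and the others vanish. Hence the number of
    -- characters times `j_α` is congruent to `|H| (i + j)`, and this witness solves for `i + j`.
    refine ⟨(Fintype.card H : k)⁻¹ • (Nat.card (Multiplicative Q →* kˣ) : k) • gproj 𝒜 α j,
      Submodule.smul_mem _ _ (Submodule.smul_mem _ _ (gproj_mem 𝒜 α j)), ?_⟩
    have h3 := I.smul_mem (-(Fintype.card H : k)⁻¹) hmem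
    rw [neg_smul, smul_sub, neg_sub, inv_smul_smul₀ hcardH] at h3
    exact h3

end Roots

/-! ### Algebras over an algebraically closed field, and the centroid. -/

/-- If `c` were transcendental, the elements `(c - a)⁻¹`, `a ∈ k`, would be `|k|` linearly
independent elements of `E`. -/
theorem algebraMap_surjective_of_rank_lt {k : Type v} {E : Type w} [Field k] [IsAlgClosed k]
    [CommRing E] [Algebra k E] (hE : IsField E)
    (h : Cardinal.lift.{v} (Module.rank k E) < Cardinal.lift.{w} (Cardinal.mk k)) :
    Function.Surjective (algebraMap k E) := by
  let _ : Field E := hE.toField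
  intro c
  have hc : IsAlgebraic k c := by
    by_contra hc
    exact h.not_ge (Transcendental.linearIndependent_sub_inv hc).cardinal_lift_le_rank
  exact minpoly.mem_range_of_degree_eq_one k c
    (IsAlgClosed.degree_eq_one_of_irreducible k (minpoly.irreducible hc.isIntegral))

theorem nonempty_algHom_of_finiteDimensional {k C : Type*} [Field k] [IsAlgClosed k] [Ring C]
    [Algebra k C] [Nontrivial C] [FiniteDimensional k C] (hcomm : ∀ a b : C, a * b = b * a) :
    Nonempty (C →ₐ[k] k) := by
  let _ : CommRing C := { ‹Ring C› with mul_comm := hcomm }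
  obtain ⟨m, hm⟩ := Ideal.exists_maximal C
  have : FiniteDimensional k (C ⧸ m) :=
    Module.Finite.of_surjective (Ideal.Quotient.mkₐ k m).toLinearMap
      (Ideal.Quotient.mkₐ_surjective k m)
  have hbij : Function.Bijective (Algebra.ofId k (C ⧸ m)) :=
    IsAlgClosed.algebraMap_bijective_of_isIntegral
  exact ⟨((AlgEquiv.ofBijective _ hbij).symm : (C ⧸ m) →ₐ[k] k).comp (Ideal.Quotient.mkₐ k m)⟩

/-- The centroid of a Lie algebra: the linear maps that commute with all inner derivations. -/
def lieCentroid (k 𝔤 : Type*) [CommRing k] [LieRing 𝔤] [LieAlgebra k 𝔤] :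
    Subalgebra k (Module.End k 𝔤) where
  carrier := {c | ∀ x y : 𝔤, c ⁅x, y⁆ = ⁅x, c y⁆}
  mul_mem' {c d} hc hd x y := by
    rw [Module.End.mul_apply, Module.End.mul_apply, hd, hc]
  add_mem' {c d} hc hd x y := by
    rw [LinearMap.add_apply, LinearMap.add_apply, hd, hc, lie_add]
  algebraMap_mem' a x y := by simp [Module.algebraMap_end_apply]

section Centroid

variable {k 𝔤 : Type*} [CommRing k] [LieRing 𝔤] [LieAlgebra k 𝔤]

theorem mem_lieCentroid {c : Module.End k 𝔤} :
    c ∈ lieCentroid k 𝔤 ↔ ∀ x y : 𝔤, c ⁅x, y⁆ = ⁅x, c y⁆ := Iff.rfl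

theorem lieCentroid_apply_lie {c : Module.End k 𝔤} (hc : c ∈ lieCentroid k 𝔤) (x y : 𝔤) :
    c ⁅x, y⁆ = ⁅c x, y⁆ := by
  rw [← lie_skew, map_neg, mem_lieCentroid.1 hc, lie_skew]

/-- Both `c d` and `d c` send `[x, y]` to `[c x, d y]`, and brackets span `𝔤`. -/
theorem lieCentroid_mul_comm (h : ⁅(⊤ : LieIdeal k 𝔤), (⊤ : LieIdeal k 𝔤)⁆ = ⊤)
    {c d : Module.End k 𝔤} (hc : c ∈ lieCentroid k 𝔤) (hd : d ∈ lieCentroid k 𝔤) :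
    c * d = d * c := by
  let S : LieIdeal k 𝔤 :=
    { LinearMap.ker (c * d - d * c) with
      lie_mem := fun {x m} hm ↦ by
        have h1 := mem_lieCentroid.1 ((lieCentroid k 𝔤).sub_mem
          (mul_mem hc hd) (mul_mem hd hc)) x m
        have hm' : (c * d - d * c) m = 0 := hm
        change (c * d - d * c) ⁅x, m⁆ = 0
        rw [h1, hm', lie_zero] }
  have hS : S = ⊤ := by
    refine eq_top_iff.2 ?_
    rw [← h, LieSubmodule.lie_le_iff]
    intro x _ y _
    change (c * d - d * c) ⁅x, y⁆ = 0
    rw [LinearMap.sub_apply, Module.End.mul_apply, Module.End.mul_apply,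
      mem_lieCentroid.1 hd, lieCentroid_apply_lie hc, lieCentroid_apply_lie hc,
      mem_lieCentroid.1 hd, sub_self]
  ext x
  have hx : x ∈ S := hS ▸ LieSubmodule.mem_top x
  have hx' : (c * d - d * c) x = 0 := hx
  rwa [LinearMap.sub_apply, sub_eq_zero] at hx'

end Centroid

theorem one_end_ne_zero {Q k 𝔤 : Type*} [AddCommGroup Q] [CommRing k] [LieRing 𝔤]
    [LieAlgebra k 𝔤] [DecidableEq Q] [Fintype Q] (𝒜 : Q → Submodule k 𝔤) [GradedLieAlgebra 𝒜]
    [IsGradedSimpleLie 𝒜] : (1 : Module.End k 𝔤) ≠ 0 := by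
  obtain ⟨α, x, hx, hx0⟩ := exists_homogeneous_ne_zero 𝒜
  exact fun h ↦ hx0 (by simpa using LinearMap.congr_fun h x)

/-! ### Homogeneous elements of the centroid. -/

section GradedCentroid

variable {Q k 𝔤 : Type*} [AddCommGroup Q] [CommRing k] [LieRing 𝔤] [LieAlgebra k 𝔤]
  (𝒜 : Q → Submodule k 𝔤)

/-- The elements of the centroid that are homogeneous of degree `γ`. -/
def centroidComponent (γ : Q) : Submodule k (Module.End k 𝔤) where
  carrier := {c | c ∈ lieCentroid k 𝔤 ∧ ∀ α, ∀ x ∈ 𝒜 α, c x ∈ 𝒜 (α + γ)}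
  add_mem' hc hd := ⟨add_mem hc.1 hd.1, fun α x hx ↦ add_mem (hc.2 α x hx) (hd.2 α x hx)⟩
  zero_mem' := ⟨zero_mem _, fun _ _ _ ↦ zero_mem _⟩
  smul_mem' a _ hc :=
    ⟨(lieCentroid k 𝔤).smul_mem hc.1 a, fun α x hx ↦ (𝒜 _).smul_mem a (hc.2 α x hx)⟩

variable {𝒜}

theorem centroidComponent_apply_mem_sub {α β : Q} {c : Module.End k 𝔤}
    (hc : c ∈ centroidComponent 𝒜 (α - β)) {x : 𝔤} (hx : x ∈ 𝒜 β) : c x ∈ 𝒜 α := by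
  simpa using hc.2 β x hx

theorem one_mem_centroidComponent : (1 : Module.End k 𝔤) ∈ centroidComponent 𝒜 (0 : Q) :=
  ⟨one_mem _, fun α x hx ↦ by simpa using hx⟩

theorem mul_mem_centroidComponent {γ δ : Q} {c d : Module.End k 𝔤}
    (hc : c ∈ centroidComponent 𝒜 γ) (hd : d ∈ centroidComponent 𝒜 δ) :
    c * d ∈ centroidComponent 𝒜 (γ + δ) :=
  ⟨mul_mem hc.1 hd.1, fun α x hx ↦ by
    rw [add_comm γ, ← add_assoc]; exact hc.2 _ _ (hd.2 α x hx)⟩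

theorem pow_mem_centroidComponent {γ : Q} {c : Module.End k 𝔤}
    (hc : c ∈ centroidComponent 𝒜 γ) (n : ℕ) : c ^ n ∈ centroidComponent 𝒜 (n • γ) := by
  induction n with
  | zero => simpa using one_mem_centroidComponent
  | succ n ih => rw [pow_succ, succ_nsmul]; exact mul_mem_centroidComponent ih hc

variable [DecidableEq Q] [Fintype Q] [GradedLieAlgebra 𝒜]

theorem gproj_add_centroid {γ : Q} {c : Module.End k 𝔤}
    (hc : c ∈ centroidComponent 𝒜 γ) (α : Q) (x : 𝔤) :
    gproj 𝒜 (α + γ) (c x) = c (gproj 𝒜 α x) := by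
  nth_rewrite 1 [← sum_gproj 𝒜 x]
  rw [map_sum, map_sum, Finset.sum_eq_single α]
  · exact gproj_of_mem (hc.2 α _ (gproj_mem 𝒜 α x))
  · intro β _ hβ
    exact gproj_of_mem_ne (hc.2 β _ (gproj_mem 𝒜 β x)) (by simpa using hβ)
  · simp

theorem mem_lieCentroid_of_homogeneous {c : Module.End k 𝔤}
    (h : ∀ α, ∀ x ∈ 𝒜 α, ∀ y, c ⁅x, y⁆ = ⁅x, c y⁆) : c ∈ lieCentroid k 𝔤 := by
  intro x y
  rw [← sum_gproj 𝒜 x]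
  simp only [sum_lie, map_sum]
  exact Finset.sum_congr rfl fun α _ ↦ h α _ (gproj_mem 𝒜 α x) y

-- As `Q` is finite, `c` is the finite sum of its homogeneous parts; comparing degrees in `c [x, y]
-- = [x, c y]` puts each part in the centroid.
variable (𝒜) in
theorem lieCentroid_le_iSup :
    (lieCentroid k 𝔤).toSubmodule ≤ ⨆ γ, centroidComponent 𝒜 γ := by
  intro c hc
  replace hc : c ∈ lieCentroid k 𝔤 := hc
  let d (γ : Q) : Module.End k 𝔤 := ∑ α, gproj 𝒜 (α + γ) ∘ₗ c ∘ₗ gproj 𝒜 α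
  have hd (γ : Q) (x : 𝔤) : d γ x = ∑ α, gproj 𝒜 (α + γ) (c (gproj 𝒜 α x)) := by simp [d]
  have hdhom (γ α : Q) (x : 𝔤) (hx : x ∈ 𝒜 α) : d γ x = gproj 𝒜 (α + γ) (c x) := by
    rw [hd, Finset.sum_eq_single α]
    · rw [gproj_of_mem hx]
    · intro β _ hβ
      rw [gproj_of_mem_ne hx hβ.symm, map_zero, map_zero]
    · simp
  have hcd : c = ∑ γ, d γ := by
    ext x
    rw [LinearMap.sum_apply, ← sum_gproj 𝒜 x]
    simp only [map_sum]
    rw [Finset.sum_comm]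
    refine Finset.sum_congr rfl fun α _ ↦ ?_
    simp only [hdhom _ α _ (gproj_mem 𝒜 α x)]
    exact (sum_gproj 𝒜 _).symm.trans
      (Equiv.sum_comp (Equiv.addLeft α) fun β ↦ gproj 𝒜 β (c (gproj 𝒜 α x))).symm
  rw [hcd]
  refine Submodule.sum_mem _ fun γ _ ↦ Submodule.mem_iSup_of_mem γ ⟨?_, ?_⟩
  · refine mem_lieCentroid_of_homogeneous (𝒜 := 𝒜) fun α x hx y ↦ ?_
    rw [← sum_gproj 𝒜 y]
    simp only [lie_sum, map_sum]
    refine Finset.sum_congr rfl fun β _ ↦ ?_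
    have hy := gproj_mem 𝒜 β y
    rw [hdhom γ β _ hy, hdhom γ (α + β) _ (SetLike.GradedBracket.bracket_mem hx hy), hc,
      add_assoc, gproj_add_lie hx]
  · intro α x hx
    rw [hdhom γ α x hx]
    exact gproj_mem 𝒜 _ _

variable [IsGradedSimpleLie 𝒜]

/-- Schur's lemma: the kernel and the range of `c` are graded ideals. -/
theorem bijective_of_mem_centroidComponent {γ : Q} {c : Module.End k 𝔤}
    (hc : c ∈ centroidComponent 𝒜 γ) (hc0 : c ≠ 0) : Function.Bijective c := by
  let K : LieIdeal k 𝔤 :=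
    { LinearMap.ker c with
      lie_mem := fun {x m} hm ↦ by
        have hm' : c m = 0 := hm
        change c ⁅x, m⁆ = 0
        rw [hc.1, hm', lie_zero] }
  let R : LieIdeal k 𝔤 :=
    { LinearMap.range c with
      lie_mem := fun {x m} hm ↦ by
        obtain ⟨y, rfl⟩ := hm
        exact ⟨⁅x, y⁆, hc.1 x y⟩ }
  have hK (x : 𝔤) : x ∈ K ↔ c x = 0 := Iff.rfl
  have hR (x : 𝔤) : x ∈ R ↔ ∃ y, c y = x := Iff.rfl
  constructor
  · rw [injective_iff_map_eq_zero]
    intro x hx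
    rcases ideal_eq_bot_or_eq_top_of_gproj_mem 𝒜 K fun α x hx ↦ by
      rw [hK] at hx ⊢; rw [← gproj_add_centroid hc, hx, map_zero] with h | h
    · rw [← hK, h] at hx
      simpa using hx
    · exact absurd (LinearMap.ext fun y ↦ (hK y).1 (h ▸ LieSubmodule.mem_top y)) hc0
  · rcases ideal_eq_bot_or_eq_top_of_gproj_mem 𝒜 R fun α x hx ↦ by
      obtain ⟨y, rfl⟩ := (hR x).1 hx
      refine (hR _).2 ⟨gproj 𝒜 (α - γ) y, ?_⟩
      rw [← gproj_add_centroid hc, sub_add_cancel] with h | h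
    · refine absurd (LinearMap.ext fun y ↦ ?_) hc0
      have : c y ∈ R := (hR _).2 ⟨y, rfl⟩
      rw [h] at this
      simpa using this
    · intro x
      exact (hR x).1 (h ▸ LieSubmodule.mem_top x)

theorem mul_ne_zero_of_mem_centroidComponent {γ : Q} {c d : Module.End k 𝔤}
    (hc : c ∈ centroidComponent 𝒜 γ) (hc0 : c ≠ 0) (hd : d ≠ 0) : c * d ≠ 0 := by
  intro h
  refine hd (LinearMap.ext fun x ↦ (bijective_of_mem_centroidComponent hc hc0).1 ?_)
  rw [← Module.End.mul_apply, h]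
  simp

theorem pow_ne_zero_of_mem_centroidComponent {γ : Q} {c : Module.End k 𝔤}
    (hc : c ∈ centroidComponent 𝒜 γ) (hc0 : c ≠ 0) (n : ℕ) : c ^ n ≠ 0 := by
  induction n with
  | zero => simpa using one_end_ne_zero 𝒜
  | succ n ih => rw [pow_succ']; exact mul_ne_zero_of_mem_centroidComponent hc hc0 ih

end GradedCentroid

/-! ### The centroid as a group algebra. -/

section ScalarCentroid

variable {Q : Type u} {k : Type v} {𝔤 : Type w} [AddCommGroup Q] [Fintype Q] [DecidableEq Q]
  [Field k] [LieRing 𝔤] [LieAlgebra k 𝔤] {𝒜 : Q → Submodule k 𝔤}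
  [GradedLieAlgebra 𝒜] [IsGradedSimpleLie 𝒜]

theorem eq_smul_one_of_mem_centroidComponent_zero [IsAlgClosed k]
    (hrank : Cardinal.lift.{v} (Module.rank k 𝔤) < Cardinal.lift.{w} (Cardinal.mk k))
    {c : Module.End k 𝔤} (hc : c ∈ centroidComponent 𝒜 0) : ∃ a : k, c = a • 1 := by
  let E : Subalgebra k (Module.End k 𝔤) :=
    { centroidComponent 𝒜 0 with
      mul_mem' := fun hc hd ↦ by simpa using mul_mem_centroidComponent hc hd
      algebraMap_mem' := fun a ↦ by
        rw [Algebra.algebraMap_eq_smul_one]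
        exact (centroidComponent 𝒜 0).smul_mem a one_mem_centroidComponent }
  have hE (c : Module.End k 𝔤) : c ∈ E ↔ c ∈ centroidComponent 𝒜 0 := Iff.rfl
  let _ : CommRing E :=
    { (inferInstance : Ring E) with
      mul_comm := fun a b ↦ Subtype.ext
        (lieCentroid_mul_comm (lie_top_top_eq_top 𝒜) a.2.1 b.2.1) }
  obtain ⟨α, x, hx, hx0⟩ := exists_homogeneous_ne_zero 𝒜
  have hfield : IsField E :=
    { exists_pair_ne := ⟨0, 1, fun h ↦ one_end_ne_zero 𝒜 (congrArg Subtype.val h).symm⟩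
      mul_comm := mul_comm
      mul_inv_cancel := by
        intro a ha
        have hb := bijective_of_mem_centroidComponent ((hE _).1 a.2)
          (fun h ↦ ha (Subtype.ext h))
        let e := LinearEquiv.ofBijective a.1 hb
        have he (y : 𝔤) : a.1 (e.symm y) = y := e.apply_symm_apply y
        refine ⟨⟨e.symm, (hE _).2 ⟨fun y z ↦ hb.1 ?_, fun β y hy ↦ ?_⟩⟩, ?_⟩
        · change a.1 (e.symm ⁅y, z⁆) = a.1 ⁅y, e.symm z⁆
          rw [he, a.2.1, he]
        · change e.symm y ∈ 𝒜 (β + 0)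
          have : e.symm y = gproj 𝒜 β (e.symm y) := hb.1 <| by
            rw [← gproj_add_centroid ((hE _).1 a.2), he, add_zero, gproj_of_mem hy]
          rw [this, add_zero]
          exact gproj_mem 𝒜 β _
        · exact Subtype.ext (LinearMap.ext he) }
  -- Nonzero elements of `E` are injective on `𝔤`, so evaluation at `x` embeds `E` into `𝔤` and
  -- bounds its dimension.
  have hev : Function.Injective ((LinearMap.applyₗ x : Module.End k 𝔤 →ₗ[k] 𝔤) ∘ₗ
      E.val.toLinearMap) := by
    rw [injective_iff_map_eq_zero]
    intro a ha
    by_contra ha0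
    have hb := bijective_of_mem_centroidComponent ((hE _).1 a.2) (fun h ↦ ha0 (Subtype.ext h))
    exact hx0 (hb.1 (by rw [map_zero]; exact ha))
  have hrankE : Cardinal.lift.{v} (Module.rank k E) < Cardinal.lift.{w} (Cardinal.mk k) :=
    (Cardinal.lift_le.2 (LinearMap.rank_le_of_injective _ hev)).trans_lt hrank
  obtain ⟨a, ha⟩ := algebraMap_surjective_of_rank_lt hfield hrankE ⟨c, (hE c).2 hc⟩
  refine ⟨a, ?_⟩
  rw [← Algebra.algebraMap_eq_smul_one]
  exact (congrArg Subtype.val ha).symm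

/-- The power has degree `|Q| γ = 0`, hence is a scalar; it is nonzero because nonzero homogeneous
elements of the centroid are injective. -/
theorem pow_card_eq_smul_one {γ : Q} {c : Module.End k 𝔤}
    (hone : ∀ c ∈ centroidComponent 𝒜 0, ∃ a : k, c = a • 1)
    (hc : c ∈ centroidComponent 𝒜 γ) (hc0 : c ≠ 0) :
    ∃ a : k, a ≠ 0 ∧ c ^ Fintype.card Q = a • 1 := by
  have h := pow_mem_centroidComponent hc (Fintype.card Q)
  rw [card_nsmul_eq_zero] at h
  obtain ⟨a, ha⟩ := hone _ h
  refine ⟨a, ?_, ha⟩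
  rintro rfl
  exact pow_ne_zero_of_mem_centroidComponent hc hc0 _ (by rw [ha, zero_smul])

/-- With `|Q| = n + 1`, the product `c ^ n * d` has degree `0`, so it is a scalar, while `c ^ n` is
the inverse of `c` up to a scalar. -/
theorem centroidComponent_eq_smul {γ : Q} {c d : Module.End k 𝔤}
    (hone : ∀ c ∈ centroidComponent 𝒜 0, ∃ a : k, c = a • 1)
    (hc : c ∈ centroidComponent 𝒜 γ) (hc0 : c ≠ 0) (hd : d ∈ centroidComponent 𝒜 γ) :
    ∃ a : k, d = a • c := by
  obtain ⟨a, ha0, ha⟩ := pow_card_eq_smul_one hone hc hc0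
  obtain ⟨n, hn⟩ : ∃ n, Fintype.card Q = n + 1 := Nat.exists_eq_succ_of_ne_zero Fintype.card_ne_zero
  have h := mul_mem_centroidComponent (pow_mem_centroidComponent hc n) hd
  rw [← succ_nsmul, ← hn, card_nsmul_eq_zero] at h
  obtain ⟨b, hb⟩ := hone _ h
  refine ⟨a⁻¹ * b, ?_⟩
  have : a • d = b • c := by
    calc a • d = c ^ Fintype.card Q * d := by rw [ha, smul_mul_assoc, one_mul]
      _ = c * (c ^ n * d) := by rw [hn, pow_succ', mul_assoc]
      _ = b • c := by rw [hb, mul_smul_comm, mul_one]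
  rw [mul_smul, ← this, inv_smul_smul₀ ha0]

theorem finiteDimensional_lieCentroid
    (hone : ∀ c ∈ centroidComponent 𝒜 0, ∃ a : k, c = a • 1) :
    FiniteDimensional k (lieCentroid k 𝔤) := by
  have (γ : Q) : FiniteDimensional k (centroidComponent 𝒜 γ) := by
    by_cases h : centroidComponent 𝒜 γ = ⊥
    · rw [h]; infer_instance
    · obtain ⟨c, hc, hc0⟩ := Submodule.exists_mem_ne_zero_of_ne_bot h
      refine Submodule.finiteDimensional_of_le (S₂ := k ∙ c) fun d hd ↦ ?_
      obtain ⟨a, rfl⟩ := centroidComponent_eq_smul hone hc hc0 hd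
      exact Submodule.smul_mem _ _ (Submodule.mem_span_singleton_self c)
  exact Submodule.finiteDimensional_of_le (lieCentroid_le_iSup 𝒜)

/-- The homogeneous part of the centroid is a group algebra. -/
theorem exists_centroid_basis [IsAlgClosed k]
    (hone : ∀ c ∈ centroidComponent 𝒜 0, ∃ a : k, c = a • 1) :
    ∃ (P : AddSubgroup Q) (t : Q → Module.End k 𝔤),
      (∀ γ, t γ ∈ centroidComponent 𝒜 γ) ∧ t 0 = 1 ∧ (∀ γ, γ ∉ P → t γ = 0) ∧
      (∀ γ, ∀ c ∈ centroidComponent 𝒜 γ, c ≠ 0 → γ ∈ P) ∧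
      ∀ γ δ, γ ∈ P → t (γ + δ) = t γ * t δ := by
  classical
  have := finiteDimensional_lieCentroid hone
  have : Nontrivial (lieCentroid k 𝔤) :=
    ⟨0, 1, fun h ↦ one_end_ne_zero 𝒜 (congrArg Subtype.val h).symm⟩
  -- Each nonzero component of the centroid is a line. Choosing in it the element with `ε = 1` makes
  -- the choices multiplicative, so no cocycle appears.
  obtain ⟨ε⟩ := nonempty_algHom_of_finiteDimensional (k := k) (C := lieCentroid k 𝔤)
    fun a b ↦ Subtype.ext (lieCentroid_mul_comm (lie_top_top_eq_top 𝒜) a.2 b.2)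
  let P : AddSubgroup Q :=
    { carrier := {γ | ∃ c ∈ centroidComponent 𝒜 γ, c ≠ 0}
      add_mem' := by
        rintro γ δ ⟨c, hc, hc0⟩ ⟨d, hd, hd0⟩
        exact ⟨c * d, mul_mem_centroidComponent hc hd,
          mul_ne_zero_of_mem_centroidComponent hc hc0 hd0⟩
      zero_mem' := ⟨1, one_mem_centroidComponent, one_end_ne_zero 𝒜⟩
      neg_mem' := by
        rintro γ ⟨c, hc, hc0⟩
        obtain ⟨n, hn⟩ : ∃ n, Fintype.card Q = n + 1 :=
          Nat.exists_eq_succ_of_ne_zero Fintype.card_ne_zero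
        have h : n • γ = -γ := by
          rw [eq_neg_iff_add_eq_zero, ← succ_nsmul, ← hn, card_nsmul_eq_zero]
        exact ⟨c ^ n, h ▸ pow_mem_centroidComponent hc n,
          pow_ne_zero_of_mem_centroidComponent hc hc0 n⟩ }
  have hP (γ : Q) : γ ∈ P ↔ ∃ c ∈ centroidComponent 𝒜 γ, c ≠ 0 := Iff.rfl
  have hex (γ : Q) (hγ : γ ∈ P) :
      ∃ c : lieCentroid k 𝔤, c.1 ∈ centroidComponent 𝒜 γ ∧ ε c = 1 := by
    obtain ⟨c, hc, hc0⟩ := (hP γ).1 hγ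
    obtain ⟨a, ha0, ha⟩ := pow_card_eq_smul_one hone hc hc0
    let c' : lieCentroid k 𝔤 := ⟨c, hc.1⟩
    have hε : ε c' ≠ 0 := by
      intro h
      have h1 : c' ^ Fintype.card Q = a • 1 := Subtype.ext ha
      have h2 := congrArg ε h1
      rw [map_pow, h, zero_pow Fintype.card_ne_zero, map_smul, map_one, smul_eq_mul,
        mul_one] at h2
      exact ha0 h2.symm
    refine ⟨(ε c')⁻¹ • c', (centroidComponent 𝒜 γ).smul_mem _ hc, ?_⟩
    rw [map_smul, smul_eq_mul, inv_mul_cancel₀ hε]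
  have huniq (γ : Q) (c d : lieCentroid k 𝔤) (hc : c.1 ∈ centroidComponent 𝒜 γ)
      (hd : d.1 ∈ centroidComponent 𝒜 γ) (hεc : ε c = 1) (hεd : ε d = 1) : c = d := by
    have hc0 : c.1 ≠ 0 := fun h ↦ by
      have : c = 0 := Subtype.ext h
      rw [this, map_zero] at hεc
      exact zero_ne_one hεc
    obtain ⟨a, ha⟩ := centroidComponent_eq_smul hone hc hc0 hd
    have ha' : d = a • c := Subtype.ext ha
    have h1 := congrArg ε ha'
    rw [map_smul, hεc, hεd, smul_eq_mul, mul_one] at h1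
    rw [ha', ← h1, one_smul]
  choose! s hs hεs using hex
  refine ⟨P, fun γ ↦ if γ ∈ P then (s γ).1 else 0, fun γ ↦ ?_, ?_, fun γ hγ ↦ if_neg hγ,
    fun γ c hc hc0 ↦ ⟨c, hc, hc0⟩, fun γ δ hγ ↦ ?_⟩
  · dsimp only
    split_ifs with h
    · exact hs γ h
    · exact zero_mem _
  · have h0 : (0 : Q) ∈ P := zero_mem P
    dsimp only
    rw [if_pos h0]
    exact congrArg Subtype.val
      (huniq 0 _ 1 (hs 0 h0) one_mem_centroidComponent (hεs 0 h0) (map_one ε))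
  · dsimp only
    by_cases hδ : δ ∈ P
    · have hγδ : γ + δ ∈ P := add_mem hγ hδ
      rw [if_pos hγ, if_pos hδ, if_pos hγδ]
      exact congrArg Subtype.val (huniq _ _ (s γ * s δ) (hs _ hγδ)
        (mul_mem_centroidComponent (hs γ hγ) (hs δ hδ)) (hεs _ hγδ)
        (by rw [map_mul, hεs γ hγ, hεs δ hδ, one_mul]))
    · rw [if_neg hδ, if_neg fun h ↦ hδ ((P.add_mem_cancel_left hγ).1 h), mul_zero]

end ScalarCentroid

/-! ### The maximal ideal defined by transport along the centroid. -/

section Symmetrization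

variable {Q : Type u} {k : Type v} {𝔤 : Type w} [AddCommGroup Q] [Fintype Q] [DecidableEq Q]
  [CommRing k] [LieRing 𝔤] [LieAlgebra k 𝔤] (𝒜 : Q → Submodule k 𝔤) [GradedLieAlgebra 𝒜]
  (t : Q → Module.End k 𝔤)

/-- Transport all homogeneous components to degree `α` by means of a family `t` of
homogeneous elements of the centroid. -/
noncomputable def transport (α : Q) : 𝔤 →ₗ[k] 𝔤 := ∑ β, t (α - β) ∘ₗ gproj 𝒜 β

theorem transport_apply (α : Q) (x : 𝔤) :
    transport 𝒜 t α x = ∑ β, t (α - β) (gproj 𝒜 β x) := by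
  simp [transport]

variable {𝒜} in
theorem transport_of_mem (α : Q) {β : Q} {x : 𝔤} (hx : x ∈ 𝒜 β) :
    transport 𝒜 t α x = t (α - β) x := by
  rw [transport_apply, Finset.sum_eq_single β]
  · rw [gproj_of_mem hx]
  · intro γ _ hγ
    rw [gproj_of_mem_ne hx hγ.symm, map_zero]
  · simp

variable {t}

theorem transport_mem (ht : ∀ γ, t γ ∈ centroidComponent 𝒜 γ) (α : Q) (x : 𝔤) :
    transport 𝒜 t α x ∈ 𝒜 α := by
  rw [transport_apply]
  exact Submodule.sum_mem _ fun β _ ↦ centroidComponent_apply_mem_sub (ht _) (gproj_mem 𝒜 β x)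

variable {𝒜} in
theorem transport_lie (ht : ∀ γ, t γ ∈ centroidComponent 𝒜 γ) {β : Q} {y : 𝔤} (hy : y ∈ 𝒜 β)
    (α : Q) (x : 𝔤) : transport 𝒜 t α ⁅y, x⁆ = ⁅y, transport 𝒜 t (α - β) x⁆ := by
  rw [← sum_gproj 𝒜 x]
  simp only [lie_sum, map_sum]
  refine Finset.sum_congr rfl fun δ _ ↦ ?_
  have hx := gproj_mem 𝒜 δ x
  rw [transport_of_mem t _ hx, transport_of_mem t _ (SetLike.GradedBracket.bracket_mem hy hx),
    mem_lieCentroid.1 (ht _).1, sub_sub]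

/-- The ideal of elements killed by all transport maps. -/
noncomputable def transportKer (ht : ∀ γ, t γ ∈ centroidComponent 𝒜 γ) : LieIdeal k 𝔤 where
  toSubmodule := ⨅ α, LinearMap.ker (transport 𝒜 t α)
  lie_mem {y x} hx := by
    refine lie_mem_of_homogeneous 𝒜 (⨅ α, LinearMap.ker (transport 𝒜 t α)) ?_ y hx
    intro β y hy x hx
    simp only [Submodule.mem_iInf, LinearMap.mem_ker] at hx ⊢
    intro α
    rw [transport_lie ht hy, hx, lie_zero]

theorem mem_transportKer {ht : ∀ γ, t γ ∈ centroidComponent 𝒜 γ} {x : 𝔤} :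
    x ∈ transportKer 𝒜 ht ↔ ∀ α, transport 𝒜 t α x = 0 := by
  change x ∈ (⨅ α, LinearMap.ker (transport 𝒜 t α)) ↔ _
  simp [Submodule.mem_iInf]

theorem mem_of_gproj_eq_zero {δ : Q} {x : 𝔤} (h : ∀ ε, ε ≠ δ → gproj 𝒜 ε x = 0) : x ∈ 𝒜 δ := by
  rw [← sum_gproj 𝒜 x, Finset.sum_eq_single δ (fun ε _ hε ↦ h ε hε) (by simp)]
  exact gproj_mem 𝒜 δ x

variable {P : AddSubgroup Q}

/-- Transports to degrees in one coset of `P` determine each other, so one of them controls the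
whole coset. -/
theorem transport_eq (hmul : ∀ γ δ, γ ∈ P → t (γ + δ) = t γ * t δ) {α β : Q} (h : β - α ∈ P)
    (x : 𝔤) : transport 𝒜 t β x = t (β - α) (transport 𝒜 t α x) := by
  rw [transport_apply, transport_apply, map_sum]
  refine Finset.sum_congr rfl fun δ _ ↦ ?_
  rw [← sub_add_sub_cancel β α δ, hmul _ _ h, Module.End.mul_apply]

/-- Modulo the common kernel of the transport maps, an element whose transports live in a single
coset is homogeneous. -/
theorem sub_transport_mem (ht : ∀ γ, t γ ∈ centroidComponent 𝒜 γ)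
    (hnot : ∀ γ, γ ∉ P → t γ = 0) (hmul : ∀ γ δ, γ ∈ P → t (γ + δ) = t γ * t δ) {α : Q} {x : 𝔤}
    (hx : ∀ β, transport 𝒜 t β x ≠ 0 → β - α ∈ P) :
    x - transport 𝒜 t α x ∈ transportKer 𝒜 ht := by
  rw [mem_transportKer]
  intro β
  rw [map_sub, transport_of_mem t β (transport_mem 𝒜 ht α x)]
  by_cases h : β - α ∈ P
  · rw [transport_eq 𝒜 hmul h, sub_self]
  · rw [hnot _ h, LinearMap.zero_apply, sub_zero]
    by_contra h0
    exact h (hx β h0)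

variable [IsGradedSimpleLie 𝒜]

/-- Elements of an ideal with minimal transport support modulo the common kernel: two degrees of
the support differ by a degree of the centroid. -/
theorem exists_centroid_of_minimal (ht : ∀ γ, t γ ∈ centroidComponent 𝒜 γ) {J : LieIdeal k 𝔤}
    {x : 𝔤} (hxJ : x ∈ J)
    (hmin : ∀ j ∈ J, j ∉ transportKer 𝒜 ht → ({β | transport 𝒜 t β x ≠ 0} : Set Q).ncard ≤
      ({β | transport 𝒜 t β j ≠ 0} : Set Q).ncard)
    {α₁ α₂ : Q} (h₁ : transport 𝒜 t α₁ x ≠ 0) (h₂ : transport 𝒜 t α₂ x ≠ 0) :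
    ∃ c ∈ centroidComponent 𝒜 (α₂ - α₁), c ≠ 0 := by
  -- An element of `J` supported in a shift of the support of `x` that misses the shift of `α₁` has
  -- smaller support, so by minimality it lies in the kernel.
  have key (γ : Q) (j : 𝔤) (hj : j ∈ J)
      (hs : ∀ β, transport 𝒜 t β x = 0 → transport 𝒜 t (γ + β) j = 0)
      (h0 : transport 𝒜 t (γ + α₁) j = 0) (β : Q) : transport 𝒜 t β j = 0 := by
    by_contra hne
    have h1 := hmin j hj fun h ↦ hne ((mem_transportKer 𝒜).1 h β)
    have h2 : ({β | transport 𝒜 t β j ≠ 0} : Set Q) ⊆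
        (γ + ·) '' (({β | transport 𝒜 t β x ≠ 0} : Set Q) \ {α₁}) := by
      intro δ hδ
      refine ⟨-γ + δ, ⟨fun h ↦ hδ ?_, fun h ↦ hδ ?_⟩, by simp⟩
      · simpa using hs _ h
      · rw [Set.mem_singleton_iff] at h
        rw [← h, add_neg_cancel_left] at h0
        exact h0
    have h3 := (Set.ncard_le_ncard h2 (Set.toFinite _)).trans (Set.ncard_image_le (Set.toFinite _))
    have h4 := Set.ncard_sdiff_singleton_lt_of_mem
      (s := ({β | transport 𝒜 t β x ≠ 0} : Set Q)) (a := α₁) h₁ (Set.toFinite _)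
    omega
  -- `D` will be the graph of the desired centroid element. It relates the transports to `γ + α₁`
  -- and `γ + α₂` of one element of `J` supported in the `γ`-shift of the support of `x`. By `key`
  -- the first entry determines the second, degree by degree.
  let D : Submodule k (𝔤 × 𝔤) :=
    { carrier := {p | ∀ γ, ∃ j ∈ J,
        (∀ β, transport 𝒜 t β x = 0 → transport 𝒜 t (γ + β) j = 0) ∧
        transport 𝒜 t (γ + α₁) j = gproj 𝒜 (γ + α₁) p.1 ∧
        transport 𝒜 t (γ + α₂) j = gproj 𝒜 (γ + α₂) p.2}
      add_mem' := by
        intro p q hp hq γ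
        obtain ⟨j, hj, hj0, hj1, hj2⟩ := hp γ
        obtain ⟨l, hl, hl0, hl1, hl2⟩ := hq γ
        refine ⟨j + l, add_mem hj hl, fun β hβ ↦ ?_, ?_, ?_⟩
        · rw [map_add, hj0 β hβ, hl0 β hβ, add_zero]
        · rw [map_add, hj1, hl1, Prod.fst_add, map_add]
        · rw [map_add, hj2, hl2, Prod.snd_add, map_add]
      zero_mem' := fun γ ↦ ⟨0, zero_mem J, by simp⟩
      smul_mem' := by
        intro a p hp γ
        obtain ⟨j, hj, hj0, hj1, hj2⟩ := hp γ
        refine ⟨a • j, J.smul_mem a hj, fun β hβ ↦ ?_, ?_, ?_⟩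
        · rw [map_smul, hj0 β hβ, smul_zero]
        · rw [map_smul, hj1, Prod.smul_fst, map_smul]
        · rw [map_smul, hj2, Prod.smul_snd, map_smul] }
  have hD (p : 𝔤 × 𝔤) : p ∈ D ↔ ∀ γ, ∃ j ∈ J,
      (∀ β, transport 𝒜 t β x = 0 → transport 𝒜 t (γ + β) j = 0) ∧
      transport 𝒜 t (γ + α₁) j = gproj 𝒜 (γ + α₁) p.1 ∧
      transport 𝒜 t (γ + α₂) j = gproj 𝒜 (γ + α₂) p.2 := Iff.rfl
  have hlie (δ : Q) (y : 𝔤) (hy : y ∈ 𝒜 δ) (p : 𝔤 × 𝔤) (hp : p ∈ D) :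
      (⁅y, p.1⁆, ⁅y, p.2⁆) ∈ D := by
    rw [hD] at hp ⊢
    intro γ
    obtain ⟨j, hj, hj0, hj1, hj2⟩ := hp (γ - δ)
    refine ⟨⁅y, j⁆, J.lie_mem hj, fun β hβ ↦ ?_, ?_, ?_⟩
    · rw [transport_lie ht hy, add_sub_right_comm, hj0 β hβ, lie_zero]
    · rw [transport_lie ht hy, add_sub_right_comm, hj1, gproj_lie hy, add_sub_right_comm]
    · rw [transport_lie ht hy, add_sub_right_comm, hj2, gproj_lie hy, add_sub_right_comm]
  have hfun (p : 𝔤 × 𝔤) (hp : p ∈ D) (γ : Q) (h : gproj 𝒜 (γ + α₁) p.1 = 0) :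
      gproj 𝒜 (γ + α₂) p.2 = 0 := by
    obtain ⟨j, hj, hj0, hj1, hj2⟩ := (hD p).1 hp γ
    rw [← hj2]
    exact key γ j hj hj0 (hj1.trans h) _
  have hbase : (transport 𝒜 t α₁ x, transport 𝒜 t α₂ x) ∈ D := by
    rw [hD]
    intro γ
    by_cases hγ : γ = 0
    · subst hγ
      refine ⟨x, hxJ, fun β hβ ↦ by rw [zero_add, hβ], ?_, ?_⟩
      · rw [zero_add, gproj_of_mem (transport_mem 𝒜 ht _ _)]
      · rw [zero_add, gproj_of_mem (transport_mem 𝒜 ht _ _)]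
    · refine ⟨0, zero_mem J, fun β _ ↦ map_zero _, ?_, ?_⟩
      · rw [map_zero, gproj_of_mem_ne (transport_mem 𝒜 ht _ _) (by simpa [eq_comm] using hγ)]
      · rw [map_zero, gproj_of_mem_ne (transport_mem 𝒜 ht _ _) (by simpa [eq_comm] using hγ)]
  let π : D →ₗ[k] 𝔤 := LinearMap.fst k 𝔤 𝔤 ∘ₗ D.subtype
  have hinj : Function.Injective π := by
    rw [injective_iff_map_eq_zero]
    rintro ⟨⟨a, b⟩, hp⟩ (h : a = 0)
    subst h
    have hb : b = 0 := eq_zero_of_gproj 𝒜 fun ε ↦ by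
      simpa using hfun _ hp (ε - α₂) (map_zero _)
    subst hb
    rfl
  -- The first entries form an ideal containing the nonzero homogeneous element `transport 𝒜 t α₁
  -- x`, hence all of `𝔤`.
  have hsurj : Function.Surjective π := by
    let R : LieIdeal k 𝔤 :=
      { LinearMap.range π with
        lie_mem := fun {y m} hm ↦ by
          refine lie_mem_of_homogeneous 𝒜 (LinearMap.range π) ?_ y hm
          rintro δ y hy _ ⟨p, rfl⟩
          exact ⟨⟨_, hlie δ y hy p.1 p.2⟩, rfl⟩ }
    have hR : R = ⊤ := eq_top_of_homogeneous_mem (transport_mem 𝒜 ht α₁ x) h₁ ⟨⟨_, hbase⟩, rfl⟩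
    intro y
    exact (hR ▸ LieSubmodule.mem_top y : y ∈ R)
  let e := LinearEquiv.ofBijective π ⟨hinj, hsurj⟩
  let T : Module.End k 𝔤 := LinearMap.snd k 𝔤 𝔤 ∘ₗ D.subtype ∘ₗ (e.symm : 𝔤 →ₗ[k] D)
  have hT (p : 𝔤 × 𝔤) (hp : p ∈ D) : T p.1 = p.2 := by
    have : e.symm p.1 = ⟨p, hp⟩ := (LinearEquiv.symm_apply_eq e).2 rfl
    change (e.symm p.1).1.2 = p.2
    rw [this]
  have hTD (y : 𝔤) : (y, T y) ∈ D := by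
    obtain ⟨⟨p, hp⟩, rfl⟩ := hsurj y
    change (p.1, T p.1) ∈ D
    rwa [hT p hp]
  refine ⟨T, ⟨mem_lieCentroid_of_homogeneous (𝒜 := 𝒜) fun δ y hy z ↦
    hT _ (hlie δ y hy _ (hTD z)), fun δ y hy ↦ ?_⟩, fun h ↦ h₂ ?_⟩
  · refine mem_of_gproj_eq_zero 𝒜 fun ε hε ↦ ?_
    have h := hfun _ (hTD y) (ε - α₂) (gproj_of_mem_ne hy fun h ↦ hε ?_)
    · simpa using h
    · rw [h]; abel
  · exact (hT _ hbase).symm.trans (by rw [h, LinearMap.zero_apply])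

/-- In a strictly larger ideal `J`, an element `x` outside the kernel of minimal support has its
support in one coset of `P`. It is then congruent to its transport, a nonzero homogeneous element of
`J`, which generates `𝔤`. -/
theorem isCoatom_transportKer (ht : ∀ γ, t γ ∈ centroidComponent 𝒜 γ) (hone : t 0 = 1)
    (hnot : ∀ γ, γ ∉ P → t γ = 0) (hmul : ∀ γ δ, γ ∈ P → t (γ + δ) = t γ * t δ)
    (hP : ∀ γ, ∀ c ∈ centroidComponent 𝒜 γ, c ≠ 0 → γ ∈ P) : IsCoatom (transportKer 𝒜 ht) := by
  constructor
  · intro h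
    obtain ⟨α, x, hx, hx0⟩ := exists_homogeneous_ne_zero 𝒜
    have h1 := (mem_transportKer 𝒜).1 (h ▸ LieSubmodule.mem_top x : x ∈ transportKer 𝒜 ht) α
    rw [transport_of_mem t α hx, sub_self, hone] at h1
    exact hx0 h1
  · intro J hJ
    obtain ⟨x, ⟨hxJ, hxI⟩, hmin⟩ := exists_minimalFor_of_wellFoundedLT
      (fun j ↦ j ∈ J ∧ j ∉ transportKer 𝒜 ht)
      (fun j ↦ ({β | transport 𝒜 t β j ≠ 0} : Set Q).ncard) (SetLike.exists_of_lt hJ)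
    obtain ⟨α, hα⟩ : ∃ α, transport 𝒜 t α x ≠ 0 := by
      rw [mem_transportKer] at hxI
      push Not at hxI
      exact hxI
    have hmin' (j : 𝔤) (hj : j ∈ J) (hjI : j ∉ transportKer 𝒜 ht) :
        ({β | transport 𝒜 t β x ≠ 0} : Set Q).ncard ≤
          ({β | transport 𝒜 t β j ≠ 0} : Set Q).ncard :=
      (le_total _ _).elim id fun h ↦ hmin ⟨hj, hjI⟩ h
    have hsub := sub_transport_mem 𝒜 ht hnot hmul (α := α) (x := x) fun β hβ ↦ by
      obtain ⟨c, hc, hc0⟩ := exists_centroid_of_minimal 𝒜 ht hxJ hmin' hα hβ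
      exact hP _ c hc hc0
    refine eq_top_of_homogeneous_mem (transport_mem 𝒜 ht α x) hα ?_
    have := sub_mem hxJ (hJ.le hsub)
    rwa [sub_sub_cancel] at this

end Symmetrization

/-! ### The algebraically closed case and the conclusion. -/

theorem exists_gradedLieIso_of_isAlgClosed {Q : Type u} {k : Type v} {𝔤 : Type w}
    [AddCommGroup Q] [Finite Q] [DecidableEq Q] [Field k] [IsAlgClosed k] [LieRing 𝔤]
    [LieAlgebra k 𝔤] [∀ P : AddSubgroup Q, DecidableEq (Q ⧸ P)] (𝒜 : Q → Submodule k 𝔤)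
    [GradedLieAlgebra 𝒜] [IsGradedSimpleLie 𝒜]
    (hrank : Cardinal.lift.{v} (Module.rank k 𝔤) < Cardinal.lift.{w} (Cardinal.mk k)) :
    ∃ (P : AddSubgroup Q) (𝔞 : Type w) (_ : LieRing 𝔞) (_ : LieAlgebra k 𝔞)
      (ℬ : Q ⧸ P → Submodule k 𝔞) (_ : GradedLieAlgebra ℬ),
      LieAlgebra.IsSimple k 𝔞 ∧ Nonempty (GradedLieIso 𝒜 (GradedLoop.grading P ℬ)) := by
  have : Fintype Q := Fintype.ofFinite Q
  obtain ⟨P, t, ht, hone, hnot, hP, hmul⟩ := exists_centroid_basis (𝒜 := 𝒜) fun c hc ↦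
    eq_smul_one_of_mem_centroidComponent_zero hrank hc
  refine ⟨P, exists_gradedLieIso_of_isCoatom 𝒜 P
    (isCoatom_transportKer 𝒜 ht hone hnot hmul hP) ?_ ?_⟩
  · intro c x hx
    rw [mem_transportKer] at hx ⊢
    intro γ
    rw [map_sum]
    simp only [transport_of_mem t γ (gproj_mem 𝒜 _ x)]
    -- As `t` vanishes off `P`, transport to `γ` sees only the components in the coset of `γ`:
    -- restricting `x` to the coset `c` either leaves it unchanged or makes it zero.
    by_cases hγ : (γ : Q ⧸ P) = c
    · have h := hx γ
      rw [transport_apply] at h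
      rw [← h, Finset.sum_filter_of_ne]
      intro α _ hα
      rw [← hγ, QuotientAddGroup.eq, neg_add_eq_sub]
      by_contra hcon
      exact hα (by rw [hnot _ hcon, LinearMap.zero_apply])
    · refine Finset.sum_eq_zero fun α hα ↦ ?_
      rw [hnot, LinearMap.zero_apply]
      intro hcon
      refine hγ ?_
      rw [← (Finset.mem_filter.1 hα).2, eq_comm, QuotientAddGroup.eq, neg_add_eq_sub]
      exact hcon
  · intro α β hαβ x hx
    refine ⟨transport 𝒜 t α x, transport_mem 𝒜 ht α x,
      sub_transport_mem 𝒜 ht hnot hmul fun γ hγ ↦ ?_⟩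
    rw [transport_of_mem t γ hx] at hγ
    by_contra hcon
    refine hγ ?_
    rw [hnot, LinearMap.zero_apply]
    intro h
    exact hcon (by simpa using add_mem h hαβ)

open scoped Classical in
theorem corollary5p2 {Q : Type u} {k : Type v} {𝔤 : Type w}
    [AddCommGroup Q] [Finite Q] [Field k] [LieRing 𝔤] [LieAlgebra k 𝔤]
    (𝒜 : Q → Submodule k 𝔤) [GradedLieAlgebra 𝒜] [IsGradedSimpleLie 𝒜]
    (h : (∃ ζ : k, IsPrimitiveRoot ζ (Nat.card Q)) ∨
      (IsAlgClosed k ∧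
        Cardinal.lift.{v} (Module.rank k 𝔤) < Cardinal.lift.{w} (Cardinal.mk k))) :
    ∃ (P : AddSubgroup Q) (𝔞 : Type w) (_ : LieRing 𝔞) (_ : LieAlgebra k 𝔞)
      (ℬ : Q ⧸ P → Submodule k 𝔞) (_ : GradedLieAlgebra ℬ),
      LieAlgebra.IsSimple k 𝔞 ∧ Nonempty (GradedLieIso 𝒜 (GradedLoop.grading P ℬ)) := by
  rcases h with ⟨ζ, hζ⟩ | ⟨hk, hrank⟩
  · exact exists_gradedLieIso_of_isPrimitiveRoot 𝒜 hζ
  · exact exists_gradedLieIso_of_isAlgClosed 𝒜 hrank
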